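/- All graphs are finite and simple. $Q_k$ is the $k$-cube (binary strings of length $k$, adjacent when they differ in exactly one position), and for $d\ge 1$ the Fibonacci cube $\Gamma_d$ is the subgraph of $Q_d$ induced by the binary strings of length $d$ without two consecutive ones. An isometric embedding is a map between vertex sets that preserves shortest-path distances. For a connected graph $G$, $\mathrm{idim}(G)$ is the least $k$ such that $G$ embeds isometrically into $Q_k$, and $\mathrm{fdim}(G)$ is the least $f\ge 1$ such that $G$ embeds isometrically into $\Gamma_f$ (each is $\infty$ if there is no such integer); $G$ is a partial cube if $\mathrm{idim}(G)<\infty$. **Theorem.** There is an algorithm which, given a partial cube $G$ with $n$ vertices through an isometric embedding $\beta\colon G\to Q_k$ with $k=\mathrm{idim}(G)$ (as an $n\times k$ table of bits), computes in $O(k^2 n)$ time an integer $f'\ge 1$ with $$f'\le \tfrac32\,\mathrm{fdim}(G)$$ and an isometric embedding of $G$ into $\Gamma_{f'}$ (as an $n\times f'$ table of bits). Time is the number of steps of a random access machine with words of $O(\log n)$ bits, a fixed number of registers and arrays, and unit-cost assignment of constants, addition, truncated subtraction, multiplication, indirect array access and comparison. The constants are absolute. In the degenerate case $k=0$, where $G$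 is a single vertex, $O(k^2n)$ is read as $O(1)$. -/

import Mathlib

/-! ### Hypercubes, Fibonacci cubes, isometric and Fibonacci dimension -/

/-- The `d`-cube: binary strings of length `d`, adjacent when they differ in exactly one place. -/
def cubeGraph (d : ℕ) : SimpleGraph (Fin d → Bool) where
  Adj u v := hammingDist u v = 1
  symm := ⟨fun u v h => by rw [hammingDist_comm]; exact h⟩
  loopless := ⟨fun u h => by simp at h⟩

/-- Binary strings of length `d` without two consecutive ones. -/
def fibStrings (d : ℕ) : Set (Fin d → Bool) :=
  {u | ∀ i j : Fin d, (j : ℕ) = (i : ℕ) + 1 → ¬ (u i = true ∧ u j = true)}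

/-- The Fibonacci cube: the subgraph of the `d`-cube induced by the Fibonacci strings. -/
def fibCube (d : ℕ) : SimpleGraph (fibStrings d) :=
  (cubeGraph d).induce (fibStrings d)

/-- `φ` preserves shortest-path distances (valued in `ℕ∞`, so that vertices in different components
are at distance `⊤`); such a map is injective. -/
def IsIsometricEmbedding {V W : Type*} (G : SimpleGraph V) (H : SimpleGraph W) (φ : V → W) : Prop :=
  ∀ u v, H.edist (φ u) (φ v) = G.edist u v

/-- The least `k` such that `G` embeds isometrically into the `k`-cube, `⊤` if there is none. -/
noncomputable def idim {V : Type*} (G : SimpleGraph V) : ℕ∞ :=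
  ⨅ (k : ℕ) (_ : ∃ φ : V → (Fin k → Bool), IsIsometricEmbedding G (cubeGraph k) φ), (k : ℕ∞)

/-- The least `f ≥ 1` such that `G` embeds isometrically into the `f`-dimensional Fibonacci cube,
`⊤` if there is none. -/
noncomputable def fdim {V : Type*} (G : SimpleGraph V) : ℕ∞ :=
  ⨅ (f : ℕ) (_ : 1 ≤ f ∧ ∃ φ : V → fibStrings f, IsIsometricEmbedding G (fibCube f) φ), (f : ℕ∞)

/-! ### A random access machine with unit-cost instructions on bounded words

A program uses finitely many registers and finitely many arrays, both named by numerals that are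
written in the program; array cells are addressed indirectly, through the content of a register. -/

/-- The contents of the registers and of the arrays. -/
structure RamState where
  reg : ℕ → ℕ
  arr : ℕ → ℕ → ℕ

/-- Overwrite register `r` with `x`. -/
def RamState.setReg (s : RamState) (r x : ℕ) : RamState :=
  { s with reg := Function.update s.reg r x }

/-- Overwrite cell `p` of array `A` with `x`. -/
def RamState.setArr (s : RamState) (A p x : ℕ) : RamState :=
  { s with arr := Function.update s.arr A (Function.update (s.arr A) p x) }

/-- Structured programs of the machine. -/
inductive RamProg where
  /-- no operation -/
  | skip : RamProg
  /-- `r := x` -/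
  | const (r x : ℕ) : RamProg
  /-- `r := a + b`, for registers `a`, `b` -/
  | add (r a b : ℕ) : RamProg
  /-- `r := max (a - b) 0` -/
  | sub (r a b : ℕ) : RamProg
  /-- `r := a * b` -/
  | mul (r a b : ℕ) : RamProg
  /-- `r := A[p]`, for an array `A` and a register `p` -/
  | load (r A p : ℕ) : RamProg
  /-- `A[p] := a`, for an array `A` and registers `p`, `a` -/
  | store (A p a : ℕ) : RamProg
  /-- first `P`, then `Q` -/
  | seq (P Q : RamProg) : RamProg
  /-- `if a < b then P else Q` -/
  | ite (a b : ℕ) (P Q : RamProg) : RamProg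
  /-- `while a < b do P` -/
  | loop (a b : ℕ) (P : RamProg) : RamProg

/-- `RamExec W P s t s'`: started in `s`, the program `P` halts in `s'` after exactly `t` steps, and
all words it writes are `< W`. Each elementary instruction and each evaluation of the test of a
conditional or of a loop is one step. The machine is stuck on overflow. -/
inductive RamExec (W : ℕ) : RamProg → RamState → ℕ → RamState → Prop where
  | skip (s : RamState) : RamExec W .skip s 1 s
  | const (s : RamState) (r x : ℕ) (h : x < W) :
      RamExec W (.const r x) s 1 (s.setReg r x)
  | add (s : RamState) (r a b : ℕ) (h : s.reg a + s.reg b < W) :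
      RamExec W (.add r a b) s 1 (s.setReg r (s.reg a + s.reg b))
  | sub (s : RamState) (r a b : ℕ) (h : s.reg a - s.reg b < W) :
      RamExec W (.sub r a b) s 1 (s.setReg r (s.reg a - s.reg b))
  | mul (s : RamState) (r a b : ℕ) (h : s.reg a * s.reg b < W) :
      RamExec W (.mul r a b) s 1 (s.setReg r (s.reg a * s.reg b))
  | load (s : RamState) (r A p : ℕ) (h : s.arr A (s.reg p) < W) :
      RamExec W (.load r A p) s 1 (s.setReg r (s.arr A (s.reg p)))
  | store (s : RamState) (A p a : ℕ) (h : s.reg a < W) :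
      RamExec W (.store A p a) s 1 (s.setArr A (s.reg p) (s.reg a))
  | seq {P Q : RamProg} {s s' s'' : RamState} {t t' : ℕ}
      (hP : RamExec W P s t s') (hQ : RamExec W Q s' t' s'') :
      RamExec W (.seq P Q) s (t + t') s''
  | ite_true {a b : ℕ} {P Q : RamProg} {s s' : RamState} {t : ℕ}
      (h : s.reg a < s.reg b) (hP : RamExec W P s t s') :
      RamExec W (.ite a b P Q) s (t + 1) s'
  | ite_false {a b : ℕ} {P Q : RamProg} {s s' : RamState} {t : ℕ}
      (h : ¬ s.reg a < s.reg b) (hQ : RamExec W Q s t s') :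
      RamExec W (.ite a b P Q) s (t + 1) s'
  | loop_done {a b : ℕ} {P : RamProg} {s : RamState} (h : ¬ s.reg a < s.reg b) :
      RamExec W (.loop a b P) s 1 s
  | loop_step {a b : ℕ} {P : RamProg} {s s' s'' : RamState} {t t' : ℕ}
      (h : s.reg a < s.reg b) (hP : RamExec W P s t s')
      (hL : RamExec W (.loop a b P) s' t' s'') :
      RamExec W (.loop a b P) s (t + t' + 1) s''

/-! ### Input and output conventions -/

/-- The input: register `0` holds `n`, register `1` holds `k`, array `0` holds the `n × k` bit table
of `β` row by row (entry `(v, i)` in cell `v * k + i`), and everything else is zero. -/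
def inputState {n k : ℕ} (β : Fin n → (Fin k → Bool)) : RamState where
  reg r := if r = 0 then n else if r = 1 then k else 0
  arr A p :=
    if h : A = 0 ∧ p < n * k then
      (β (finProdFinEquiv.symm ⟨p, h.2⟩).1 (finProdFinEquiv.symm ⟨p, h.2⟩).2).toNat
    else 0

/-- The output: register `0` holds `f`, and array `1` holds the `n × f` bit table of `φ` row by row
(entry `(v, i)` in cell `v * f + i`). -/
def IsOutput {n f : ℕ} (s : RamState) (φ : Fin n → fibStrings f) : Prop :=
  s.reg 0 = f ∧
    ∀ (v : Fin n) (i : Fin f), s.arr 1 ((v : ℕ) * f + (i : ℕ)) = ((φ v : Fin f → Bool) i).toNat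

/-! ### Hamming distance and shortest paths -/

/-! Fibonacci cubes are isometric in cubes (`fibCube_edist`), so everything is about bit tables. An
edge of `G` changes exactly one bit, and a column is recovered up to complement from distances to
the ends of such an edge. Hence every isometric labelling contains the `k` cuts of `β`
(`exists_matching_cuts`), and embedding into a Fibonacci cube means choosing signs, ordering the
columns and inserting zero columns so that consecutive columns are never both one.

The greedy algorithm grows a sequence of signed columns. If some unused column, under some signs, is
disjoint from the last column, it is appended when the sign of the last column fits (`snoc`).
Otherwise the last column is complemented and the new one goes before it, which keeps the earlier
disjointness because the bit sets involved are nested (`insert`). If no unused column works, a zero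
column is inserted, and the column before it is disjoint from no later column under any signs.

With `T` gapless links the output has `f' = 2k - 1 - T` columns. Two columns that both fail to start
a gapless link cannot be adjacent in any embedding into a Fibonacci cube of dimension `f`. So the at
most `T` columns starting such links cover all adjacencies there, each at most two of them, and `2k
≤ f + 1 + 2T` (`two_mul_le_of_covered`). With `k ≤ f` this gives `2f' ≤ 3f` (`two_mul_le`).

Each of the fewer than `k` placements scans `k` columns, reading `n` rows for each to see which of
the four bit pairs occur; this is the `k²n` bound. The bound `k ≤ n²` (`le_card_sq`) keeps all
numbers polynomial in `n`. -/

theorem hammingDist_update_add_one {d : ℕ} (x y : Fin d → Bool) (t : Fin d) (h : x t ≠ y t) :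
    hammingDist (Function.update x t (y t)) y + 1 = hammingDist x y := by
  classical
  have h1 : (Finset.univ.filter fun i => Function.update x t (y t) i ≠ y i)
      = (Finset.univ.filter fun i => x i ≠ y i).erase t := by
    ext i
    by_cases hi : i = t
    · subst hi; simp
    · simp [hi]
  unfold hammingDist
  rw [h1, Finset.card_erase_add_one (by simpa using h)]

theorem hammingDist_update_self {d : ℕ} (x : Fin d → Bool) (t : Fin d) (b : Bool) (h : x t ≠ b) :
    hammingDist x (Function.update x t b) = 1 := by
  have := hammingDist_update_add_one x (Function.update x t b) t (by simpa using h)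
  simpa using this.symm

theorem eq_update_of_hammingDist_eq_one {d : ℕ} {x y : Fin d → Bool} (h : hammingDist x y = 1)
    {t : Fin d} (ht : x t ≠ y t) : Function.update x t (y t) = y := by
  have := hammingDist_update_add_one x y t ht
  exact hammingDist_eq_zero.1 (by omega)

/-- In a cube, the endpoint of an edge in direction `t` that agrees with `x` at `t` is the one
closer to `x`. -/
theorem apply_eq_iff_hammingDist_lt {d : ℕ} {u v : Fin d → Bool} (h : hammingDist u v = 1)
    {t : Fin d} (ht : u t ≠ v t) (x : Fin d → Bool) :
    x t = u t ↔ hammingDist x u < hammingDist x v := by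
  have huv := eq_update_of_hammingDist_eq_one h ht
  have hvu := eq_update_of_hammingDist_eq_one (hammingDist_comm u v ▸ h) ht.symm
  rw [hammingDist_comm x u, hammingDist_comm x v]
  by_cases hx : x t = u t
  · have := hammingDist_update_add_one v x t (by rw [hx]; exact ht.symm)
    rw [hx, hvu] at this
    simp only [hx, true_iff]; omega
  · have hxv : x t = v t := by
      revert hx ht; cases x t <;> cases u t <;> cases v t <;> simp
    have := hammingDist_update_add_one u x t (by rw [hxv]; exact ht)
    rw [hxv, huv] at this
    simp only [hx, false_iff]; omega

theorem hammingDist_le_edist {W : Type*} {d : ℕ} (H : SimpleGraph W) (g : W → Fin d → Bool)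
    (hg : ∀ u v, H.Adj u v → hammingDist (g u) (g v) ≤ 1) (u v : W) :
    (hammingDist (g u) (g v) : ℕ∞) ≤ H.edist u v := by
  refine le_iInf fun w => ?_
  norm_cast
  induction w with
  | nil => simp
  | @cons a b c h p ih =>
    refine (hammingDist_triangle _ (g b) _).trans ?_
    have := hg _ _ h
    rw [SimpleGraph.Walk.length_cons]
    omega

/-- Allowing the approaching step at either end matters: in a Fibonacci cube one can always erase a
one but not always create one. -/
theorem edist_le_hammingDist {W : Type*} {d : ℕ} (H : SimpleGraph W) (g : W → Fin d → Bool)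
    (hg : ∀ u v, u ≠ v → ∃ w,
      (H.Adj u w ∧ hammingDist (g w) (g v) + 1 = hammingDist (g u) (g v)) ∨
      (H.Adj w v ∧ hammingDist (g u) (g w) + 1 = hammingDist (g u) (g v))) (u v : W) :
    H.edist u v ≤ (hammingDist (g u) (g v) : ℕ∞) := by
  induction hd : hammingDist (g u) (g v) generalizing u v with
  | zero =>
    by_cases huv : u = v
    · simp [huv]
    · obtain ⟨w, ⟨-, h⟩ | ⟨-, h⟩⟩ := hg u v huv <;> omega
  | succ m ih =>
    by_cases huv : u = v
    · simp [huv]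
    · obtain ⟨w, ⟨hw, h⟩ | ⟨hw, h⟩⟩ := hg u v huv
      · refine (SimpleGraph.edist_triangle (v := w)).trans ?_
        rw [SimpleGraph.edist_eq_one_iff_adj.2 hw, add_comm]
        push_cast
        gcongr
        exact ih w v (by omega)
      · refine (SimpleGraph.edist_triangle (v := w)).trans ?_
        rw [SimpleGraph.edist_eq_one_iff_adj.2 hw]
        push_cast
        gcongr
        exact ih u w (by omega)

theorem cubeGraph_edist {d : ℕ} (x y : Fin d → Bool) :
    (cubeGraph d).edist x y = (hammingDist x y : ℕ∞) := by
  refine le_antisymm (edist_le_hammingDist _ id (fun u v huv => ?_) x y)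
    (hammingDist_le_edist _ id (fun u v h => le_of_eq h) x y)
  obtain ⟨t, ht⟩ := Function.ne_iff.1 huv
  exact ⟨Function.update u t (v t), Or.inl
    ⟨hammingDist_update_self u t _ ht, hammingDist_update_add_one u v t ht⟩⟩

theorem update_false_mem_fibStrings {d : ℕ} {x : Fin d → Bool} (hx : x ∈ fibStrings d)
    (t : Fin d) : Function.update x t false ∈ fibStrings d := by
  intro i j hij h
  refine hx i j hij ?_
  by_cases hi : i = t
  · simp [hi] at h
  · by_cases hj : j = t
    · simp [hj] at h
    · simpa [hi, hj] using h

/-- Where two strings differ, exactly one of them has a one; erasing it stays inside the Fibonacci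
strings and brings the two closer. -/
theorem fibCube_edist {d : ℕ} (x y : fibStrings d) :
    (fibCube d).edist x y = (hammingDist (x : Fin d → Bool) y : ℕ∞) := by
  refine le_antisymm (edist_le_hammingDist _ Subtype.val (fun u v huv => ?_) x y)
    (hammingDist_le_edist _ Subtype.val (fun u v h => le_of_eq h) x y)
  have huv' : (u : Fin d → Bool) ≠ v := fun h => huv (Subtype.ext h)
  obtain ⟨t, ht⟩ := Function.ne_iff.1 huv'
  cases hu : (u : Fin d → Bool) t with
  | true =>
    have hv : (v : Fin d → Bool) t = false := by
      cases hv : (v : Fin d → Bool) t with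
      | true => exact absurd (hu.trans hv.symm) ht
      | false => rfl
    refine ⟨⟨_, update_false_mem_fibStrings u.2 t⟩, Or.inl
      ⟨hammingDist_update_self _ t _ (by simp [hu]), ?_⟩⟩
    have := hammingDist_update_add_one u.1 v.1 t ht
    rwa [hv] at this
  | false =>
    have hv : (v : Fin d → Bool) t = true := by
      cases hv : (v : Fin d → Bool) t with
      | true => rfl
      | false => exact absurd (hu.trans hv.symm) ht
    refine ⟨⟨_, update_false_mem_fibStrings v.2 t⟩, Or.inr ⟨?_, ?_⟩⟩
    · have := hammingDist_update_self v.1 t false (by simp [hv])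
      rw [hammingDist_comm] at this
      exact this
    · have := hammingDist_update_add_one v.1 u.1 t ht.symm
      rw [hu] at this
      rw [hammingDist_comm u.1 v.1, hammingDist_comm u.1]
      exact this

/-! ### Cuts of a partial cube -/

/-- Distances in `G` are the Hamming distances of the labels. -/
def IsHammingLabelling {V : Type*} {d : ℕ} (G : SimpleGraph V) (β : V → Fin d → Bool) : Prop :=
  ∀ u v, G.edist u v = (hammingDist (β u) (β v) : ℕ∞)

theorem isHammingLabelling_iff {V : Type*} {d : ℕ} {G : SimpleGraph V} {β : V → Fin d → Bool} :
    IsHammingLabelling G β ↔ IsIsometricEmbedding G (cubeGraph d) β := by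
  simp only [IsHammingLabelling, IsIsometricEmbedding, cubeGraph_edist, eq_comm]

theorem isHammingLabelling_val_iff {V : Type*} {d : ℕ} {G : SimpleGraph V} {φ : V → fibStrings d} :
    IsHammingLabelling G (fun v => (φ v : Fin d → Bool)) ↔
      IsIsometricEmbedding G (fibCube d) φ := by
  simp only [IsHammingLabelling, IsIsometricEmbedding, fibCube_edist, eq_comm]

theorem IsHammingLabelling.hammingDist_eq_one {V : Type*} {d : ℕ} {G : SimpleGraph V}
    {β : V → Fin d → Bool} (hβ : IsHammingLabelling G β) {u v : V} (h : G.Adj u v) :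
    hammingDist (β u) (β v) = 1 := by
  have := hβ u v
  rw [SimpleGraph.edist_eq_one_iff_adj.2 h] at this
  exact_mod_cast this.symm

theorem SimpleGraph.Connected.exists_adj_apply_ne {V α : Type*} {G : SimpleGraph V}
    (hG : G.Connected) (g : V → α) {x y : V} (hxy : g x ≠ g y) :
    ∃ u v, G.Adj u v ∧ g u ≠ g v := by
  by_contra! hc
  obtain ⟨p⟩ := hG.preconnected x y
  refine hxy ?_
  clear hxy
  induction p with
  | nil => rfl
  | cons h p ih => exact (hc _ _ h).trans ih

theorem hammingDist_eq_sum {d : ℕ} (x y : Fin d → Bool) :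
    hammingDist x y = ∑ i, if x i ≠ y i then 1 else 0 := by
  unfold hammingDist
  rw [Finset.card_filter]

/-- A constant column could be deleted, giving an isometric embedding into a smaller cube. -/
theorem exists_apply_ne_of_idim_eq {V : Type*} {k : ℕ} {G : SimpleGraph V} {β : V → Fin k → Bool}
    (hβ : IsHammingLabelling G β) (hk : idim G = (k : ℕ∞)) (i : Fin k) :
    ∃ u v, β u i ≠ β v i := by
  by_contra! hc
  obtain _ | k := k
  · exact i.elim0
  have hγ : IsHammingLabelling G (fun v (j : Fin k) => β v (i.succAbove j)) := by
    intro u v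
    rw [hβ u v, hammingDist_eq_sum, hammingDist_eq_sum, Fin.sum_univ_succAbove _ i]
    simp [hc u v]
  have : idim G ≤ (k : ℕ∞) := iInf₂_le k ⟨_, isHammingLabelling_iff.1 hγ⟩
  rw [hk] at this
  norm_cast at this
  omega

theorem exists_cut_edges {V : Type*} {k : ℕ} {G : SimpleGraph V} {β : V → Fin k → Bool}
    (hG : G.Connected) (hc : ∀ i, ∃ u v, β u i ≠ β v i) :
    ∃ p q : Fin k → V, ∀ i, G.Adj (p i) (q i) ∧ β (p i) i ≠ β (q i) i := by
  have h : ∀ i, ∃ u v, G.Adj u v ∧ β u i ≠ β v i := fun i => by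
    obtain ⟨u, v, h⟩ := hc i
    exact hG.exists_adj_apply_ne (fun v => β v i) h
  choose p q h using h
  exact ⟨p, q, h⟩

theorem IsHammingLabelling.eq_of_apply_ne {V : Type*} {d : ℕ} {G : SimpleGraph V}
    {β : V → Fin d → Bool} (hβ : IsHammingLabelling G β) {u v : V} (h : G.Adj u v) {i j : Fin d}
    (hi : β u i ≠ β v i) (hj : β u j ≠ β v j) : i = j := by
  have h1 := eq_update_of_hammingDist_eq_one (hβ.hammingDist_eq_one h) hi
  by_contra hij
  apply hj
  rw [← h1, Function.update_of_ne (Ne.symm hij)]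

/-- An edge crosses only one cut, so edges chosen for different cuts differ. This bound makes words
of `O(log n)` bits suffice. -/
theorem IsHammingLabelling.le_card_sq {n k : ℕ} {G : SimpleGraph (Fin n)} {β : Fin n → Fin k → Bool}
    (hβ : IsHammingLabelling G β) (hG : G.Connected) (hc : ∀ i, ∃ u v, β u i ≠ β v i) :
    k ≤ n ^ 2 := by
  obtain ⟨p, q, h⟩ := exists_cut_edges hG hc
  have hinj : Function.Injective fun i => (p i, q i) := by
    intro i j hij
    simp only [Prod.mk.injEq] at hij
    have hj := (h j).2
    rw [← hij.1, ← hij.2] at hj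
    exact hβ.eq_of_apply_ne (h i).1 (h i).2 hj
  have := Fintype.card_le_of_injective _ hinj
  simpa [sq] using this

/-- Two isometric labellings have the same cuts. -/
theorem IsHammingLabelling.exists_matching_cuts {V : Type*} {k f : ℕ} {G : SimpleGraph V}
    {β : V → Fin k → Bool} {ψ : V → Fin f → Bool} (hG : G.Connected)
    (hβ : IsHammingLabelling G β) (hψ : IsHammingLabelling G ψ)
    (hc : ∀ i, ∃ u v, β u i ≠ β v i) :
    ∃ (ι : Fin k → Fin f) (a : Fin k → Bool), Function.Injective ι ∧
      ∀ i w, β w i = a i ↔ ψ w (ι i) = true := by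
  obtain ⟨p, q, h⟩ := exists_cut_edges hG hc
  have hdist : ∀ u v, hammingDist (β u) (β v) = hammingDist (ψ u) (ψ v) := fun u v => by
    have := (hβ u v).symm.trans (hψ u v)
    exact_mod_cast this
  have ht : ∀ i, ∃ t, ψ (p i) t ≠ ψ (q i) t := fun i => by
    refine Function.ne_iff.1 fun he => ?_
    have := hψ.hammingDist_eq_one (h i).1
    simp [he] at this
  choose ι hι using ht
  -- Both sides say that `w` is nearer to `p i` than to `q i`, a condition on distances in `G`
  -- alone.
  have hcut : ∀ i w, β w i = β (p i) i ↔ ψ w (ι i) = ψ (p i) (ι i) := fun i w => by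
    rw [apply_eq_iff_hammingDist_lt (hβ.hammingDist_eq_one (h i).1) (h i).2,
      apply_eq_iff_hammingDist_lt (hψ.hammingDist_eq_one (h i).1) (hι i), hdist, hdist]
  refine ⟨ι, fun i => if ψ (p i) (ι i) = true then β (p i) i else !β (p i) i, ?_, ?_⟩
  -- If `ι i = ι j`, then columns `i` and `j` of `β` agree up to complement, so the edge chosen for
  -- `i` also crosses cut `j`.
  · intro i j hij
    refine hβ.eq_of_apply_ne (h i).1 (h i).2 fun he => ?_
    have h1 := hcut j (p i)
    have h2 := hcut j (q i)
    have h3 := hι i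
    rw [← hij] at h1 h2
    rw [← he] at h2
    revert h1 h2 h3
    cases β (p i) j <;> cases β (p j) j <;> cases ψ (p i) (ι i) <;> cases ψ (q i) (ι i) <;>
      cases ψ (p j) (ι i) <;> simp
  · intro i w
    have h1 := hcut i w
    beta_reduce
    generalize ψ (p i) (ι i) = b₁, β w i = b₂, β (p i) i = b₃, ψ w (ι i) = b₄ at h1 ⊢
    revert b₁ b₂ b₃ b₄
    decide

/-! ### The lower bound -/

/-- Inclusion–exclusion for the occupied positions and their shift by one: the union lies in `{0, …,
f}`, and the intersection counts adjacent occupied positions. -/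
theorem two_mul_le_of_covered {k f : ℕ} (ι : Fin k → Fin f) (hι : Function.Injective ι)
    (N : Finset (Fin k)) (hN : ∀ i j, (ι j : ℕ) = ι i + 1 → i ∈ N ∨ j ∈ N) :
    2 * k ≤ f + 1 + 2 * N.card := by
  classical
  have hinj : Function.Injective fun i => (ι i : ℕ) := Fin.val_injective.comp hι
  have hinj' : Function.Injective fun i => (ι i : ℕ) + 1 := (add_left_injective 1).comp hinj
  have h1 := Finset.card_union_add_card_inter (Finset.univ.image fun i => (ι i : ℕ))
    (Finset.univ.image fun i => (ι i : ℕ) + 1)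
  rw [Finset.card_image_of_injective _ hinj, Finset.card_image_of_injective _ hinj',
    Finset.card_univ, Fintype.card_fin] at h1
  have h2 : ((Finset.univ.image fun i => (ι i : ℕ)) ∪
      (Finset.univ.image fun i => (ι i : ℕ) + 1)).card ≤ f + 1 := by
    rw [← Finset.card_range (f + 1)]
    refine Finset.card_le_card fun x hx => ?_
    simp only [Finset.mem_union, Finset.mem_image, Finset.mem_univ, true_and] at hx
    rw [Finset.mem_range]
    obtain ⟨i, rfl⟩ | ⟨i, rfl⟩ := hx <;> have := (ι i).2 <;> omega
  -- Each adjacent pair is charged to a member in `N`: its right position is then that member's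
  -- position or the position plus one.
  have h3 : ((Finset.univ.image fun i => (ι i : ℕ)) ∩
      (Finset.univ.image fun i => (ι i : ℕ) + 1)) ⊆
      (N.image fun i => (ι i : ℕ)) ∪ (N.image fun i => (ι i : ℕ) + 1) := by
    intro x hx
    simp only [Finset.mem_inter, Finset.mem_image, Finset.mem_univ, true_and] at hx
    obtain ⟨⟨j, rfl⟩, i, hi⟩ := hx
    rw [Finset.mem_union]
    rcases hN i j hi.symm with h | h
    · exact Or.inr (Finset.mem_image.2 ⟨i, h, hi⟩)
    · exact Or.inl (Finset.mem_image_of_mem _ h)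
  have h4 := (Finset.card_le_card h3).trans (Finset.card_union_le _ _)
  rw [Finset.card_image_of_injective _ hinj, Finset.card_image_of_injective _ hinj'] at h4
  omega

/-! ### Layouts: the combinatorial state of the greedy algorithm -/

/-- No row of the table `A` has entry `a` in column `i` and entry `y` in column `j`. -/
def ColumnsAvoid (n k : ℕ) (A : ℕ → ℕ) (i a j y : ℕ) : Prop :=
  ∀ v < n, ¬ (A (v * k + i) = a ∧ A (v * k + j) = y)

theorem ColumnsAvoid.symm {n k : ℕ} {A : ℕ → ℕ} {i a j y : ℕ} (h : ColumnsAvoid n k A i a j y) :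
    ColumnsAvoid n k A j y i a := fun v hv hc => h v hv hc.symm

/-- The first `m` places of a sequence of signed columns `(S t, L t)` of the table `A`. Place `t` is
written to output column `Q t`, and `U` marks the columns in use. Successive places are either
disjoint, or separated by an empty output column; in the latter case the last place before the gap
is disjoint from no column used later. -/
structure IsLayout (n k : ℕ) (A : ℕ → ℕ) (m : ℕ) (S L Q U : ℕ → ℕ) : Prop where
  lt : ∀ t < m, S t < k
  bit : ∀ t < m, L t ≤ 1
  inj : ∀ t < m, ∀ r < m, S t = S r → t = r
  used : ∀ j < k, U j < 1 ↔ ∀ t < m, S t ≠ j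
  zero : Q 0 = 0
  link : ∀ t, t + 1 < m →
    (Q (t + 1) = Q t + 1 ∧ ColumnsAvoid n k A (S t) (L t) (S (t + 1)) (L (t + 1))) ∨
    (Q (t + 1) = Q t + 2 ∧ ∀ j < k, (∀ r ≤ t, S r ≠ j) → ∀ a ≤ 1, ∀ y ≤ 1,
      ¬ ColumnsAvoid n k A (S t) a j y)

namespace IsLayout

variable {n k p : ℕ} {A S L Q U : ℕ → ℕ}

theorem snoc (h : IsLayout n k A (p + 1) S L Q U) {j y q : ℕ} (hj : j < k) (hU : U j < 1)
    (hy : y ≤ 1)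
    (hq : (q = Q p + 1 ∧ ColumnsAvoid n k A (S p) (L p) j y) ∨
      (q = Q p + 2 ∧ ∀ j < k, U j < 1 → ∀ a ≤ 1, ∀ y ≤ 1, ¬ ColumnsAvoid n k A (S p) a j y)) :
    IsLayout n k A (p + 2) (Function.update S (p + 1) j) (Function.update L (p + 1) y)
      (Function.update Q (p + 1) q) (Function.update U j 1) := by
  have hfree := (h.used j hj).1 hU
  have hne : ∀ t, t < p + 1 → t ≠ p + 1 := fun t ht => by omega
  refine ⟨?_, ?_, ?_, ?_, ?_, ?_⟩
  · intro t ht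
    by_cases he : t = p + 1
    · simpa [he] using hj
    · simpa [he] using h.lt t (by omega)
  · intro t ht
    by_cases he : t = p + 1
    · simpa [he] using hy
    · simpa [he] using h.bit t (by omega)
  · intro t ht r hr
    by_cases he : t = p + 1 <;> by_cases he' : r = p + 1
    · simp [he, he']
    · simp only [he, Function.update_self, Function.update_of_ne he']
      exact fun hc => absurd hc.symm (hfree r (by omega))
    · simp only [he', Function.update_self, Function.update_of_ne he]
      exact fun hc => absurd hc (hfree t (by omega))
    · simp only [Function.update_of_ne he, Function.update_of_ne he']
      exact h.inj t (by omega) r (by omega)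
  · intro i hi
    by_cases hij : i = j
    · subst hij
      simp only [Function.update_self, lt_irrefl, false_iff]
      intro hc
      exact hc (p + 1) (by omega) (by simp)
    · rw [Function.update_of_ne hij, h.used i hi]
      constructor
      · intro hc t ht
        by_cases he : t = p + 1
        · simpa [he] using Ne.symm hij
        · simpa [he] using hc t (by omega)
      · intro hc t ht
        have := hc t (by omega)
        rwa [Function.update_of_ne (hne t ht)] at this
  · rw [Function.update_of_ne (by omega)]
    exact h.zero
  · intro t ht
    by_cases he : t = p
    · subst he
      simp only [Function.update_self, Function.update_of_ne (hne t (by omega))]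
      refine hq.imp_right fun hq => ⟨hq.1, fun i hi hr => ?_⟩
      refine hq.2 i hi ((h.used i hi).2 fun r hr' => ?_)
      have := hr r (by omega)
      rwa [Function.update_of_ne (hne r hr')] at this
    · have h1 := h.link t (by omega)
      simp only [Function.update_of_ne (hne t (by omega)),
        Function.update_of_ne (hne (t + 1) (by omega))]
      refine h1.imp_right fun h1 => ⟨h1.1, fun i hi hr => h1.2 i hi fun r hr' => ?_⟩
      have := hr r hr'
      rwa [Function.update_of_ne (hne r (by omega))] at this

/-- Reading the last column with the other sign, a new column can be inserted before it. -/
theorem insert (hA : ∀ c, A c ≤ 1) (h : IsLayout n k A (p + 1) S L Q U) {j a y : ℕ} (hj : j < k)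
    (hU : U j < 1) (ha : a ≤ 1) (hy : y ≤ 1) (haL : a ≠ L p)
    (hd : ColumnsAvoid n k A (S p) a j y) :
    IsLayout n k A (p + 2) (Function.update (Function.update S (p + 1) (S p)) p j)
      (Function.update (Function.update L (p + 1) a) p y)
      (Function.update Q (p + 1) (Q p + 1)) (Function.update U j 1) := by
  have hfree := (h.used j hj).1 hU
  have hL := h.bit p (by omega)
  have hne : ∀ t, t < p → t ≠ p + 1 := fun t ht => by omega
  have hne' : ∀ t, t < p → t ≠ p := fun t ht => by omega
  have hp : p + 1 ≠ p := by omega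
  refine ⟨?_, ?_, ?_, ?_, ?_, ?_⟩
  · intro t ht
    by_cases he : t = p
    · simpa [he] using hj
    · by_cases he' : t = p + 1
      · simpa [he'] using h.lt p (by omega)
      · simpa [he, he'] using h.lt t (by omega)
  · intro t ht
    by_cases he : t = p
    · simpa [he] using hy
    · by_cases he' : t = p + 1
      · simpa [he'] using ha
      · simpa [he, he'] using h.bit t (by omega)
  · have key : ∀ t, t < p + 2 →
        Function.update (Function.update S (p + 1) (S p)) p j t =
          if t = p then j else if t = p + 1 then S p else S t := by
      intro t ht
      simp only [Function.update_apply]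
    intro t ht r hr
    rw [key t ht, key r hr]
    have h1 := fun (hr : r < p + 1) => hfree r hr
    have h2 := fun (ht : t < p + 1) => hfree t ht
    have h3 := hfree p (by omega)
    have h4 := fun (ht : t < p + 1) => h.inj t ht p (by omega)
    have h5 := fun (hr : r < p + 1) => h.inj p (by omega) r hr
    have h6 := fun (ht : t < p + 1) (hr : r < p + 1) => h.inj t ht r hr
    split_ifs <;> intro hc <;> grind
  · intro i hi
    by_cases hij : i = j
    · subst hij
      simp only [Function.update_self, lt_irrefl, false_iff]
      intro hc
      exact hc p (by omega) (by simp)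
    · rw [Function.update_of_ne hij, h.used i hi]
      constructor
      · intro hc t ht
        by_cases he : t = p
        · simpa [he] using Ne.symm hij
        · by_cases he' : t = p + 1
          · simpa [he'] using hc p (by omega)
          · simpa [he, he'] using hc t (by omega)
      · intro hc t ht
        by_cases he : t = p
        · subst he
          have := hc (t + 1) (by omega)
          rwa [Function.update_of_ne hp, Function.update_self] at this
        · have := hc t (by omega)
          rwa [Function.update_of_ne he, Function.update_of_ne (by omega)] at this
  · rw [Function.update_of_ne (by omega)]
    exact h.zero
  · intro t ht
    rcases lt_trichotomy (t + 1) p with hlt | heq | hgt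
    · have h1 := h.link t (by omega)
      simp only [Function.update_of_ne (hne t (by omega)), Function.update_of_ne (hne' t (by omega)),
        Function.update_of_ne (hne (t + 1) (by omega)),
        Function.update_of_ne (hne' (t + 1) (by omega))]
      refine h1.imp_right fun h1 => ⟨h1.1, fun i hi hr => h1.2 i hi fun r hr' => ?_⟩
      have := hr r hr'
      rwa [Function.update_of_ne (hne' r (by omega)), Function.update_of_ne (hne r (by omega))]
        at this
    · subst heq
      have h1 := h.link t (by omega)
      simp only [Function.update_self, Function.update_of_ne (hne t (by omega)),
        Function.update_of_ne (hne' t (by omega)),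
        Function.update_of_ne hp.symm]
      rcases h1 with ⟨h1, h2⟩ | ⟨h1, h2⟩
      -- A row carrying the sign of the preceding place misses the old sign of the last column, so
      -- it has the opposite bit `a` there, and therefore misses `y` in the inserted column.
      · refine Or.inl ⟨h1, fun v hv hc => ?_⟩
        have e1 := h2 v hv
        have e2 := hd v hv
        have e3 := hA (v * k + S (t + 1))
        have e4 : A (v * k + S (t + 1)) ≠ L (t + 1) := fun he => e1 ⟨hc.1, he⟩
        exact e2 ⟨by omega, hc.2⟩
      · refine Or.inr ⟨h1, fun i hi hr => h2 i hi fun r hr' => ?_⟩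
        have := hr r hr'
        rwa [Function.update_of_ne (hne' r (by omega)), Function.update_of_ne (hne r (by omega))]
          at this
    · obtain rfl : t = p := by omega
      simp only [Function.update_self, Function.update_of_ne hp, Function.update_of_ne hp.symm,
        true_and]
      exact Or.inl hd.symm

theorem lt_of_lt {m : ℕ} (h : IsLayout n k A m S L Q U) {t r : ℕ} (htr : t < r) (hr : r < m) :
    Q t < Q r := by
  induction r with
  | zero => omega
  | succ r ih =>
    have h1 : Q r < Q (r + 1) := by
      rcases h.link r hr with h1 | h1 <;> omega
    rcases Nat.lt_succ_iff_lt_or_eq.1 htr with h2 | rfl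
    · exact (ih h2 (by omega)).trans h1
    · exact h1

theorem column_inj {m : ℕ} (h : IsLayout n k A m S L Q U) {t r : ℕ} (ht : t < m) (hr : r < m)
    (he : Q t = Q r) : t = r := by
  rcases lt_trichotomy t r with h1 | h1 | h1
  · exact absurd (h.lt_of_lt h1 hr) (by omega)
  · exact h1
  · exact absurd (h.lt_of_lt h1 ht) (by omega)

/-- Every link advances the output column by two, except that gapless ones advance it by one. -/
theorem column_add_card {m : ℕ} (h : IsLayout n k A m S L Q U) (q : ℕ) (hq : q < m) :
    Q q + ((Finset.range q).filter fun t => Q (t + 1) = Q t + 1).card = 2 * q := by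
  induction q with
  | zero => simp [h.zero]
  | succ q ih =>
    have := ih (by omega)
    rw [Finset.range_add_one, Finset.filter_insert]
    rcases h.link q hq with h1 | h1
    · rw [if_pos h1.1, Finset.card_insert_of_notMem (by simp)]
      omega
    · rw [if_neg (by omega)]
      omega

theorem column_le {m : ℕ} (h : IsLayout n k A m S L Q U) (q : ℕ) (hq : q < m) : Q q ≤ 2 * q :=
  (Nat.le_add_right _ _).trans (h.column_add_card q hq).le

theorem exists_unused {m : ℕ} (h : IsLayout n k A m S L Q U) (hm : m < k) :
    ∃ j < k, U j < 1 := by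
  by_contra! hno
  have hex : ∀ j : Fin k, ∃ t : Fin m, S t = j := fun j => by
    have := (not_iff_not.2 (h.used j j.2)).1 (by have := hno j j.2; omega)
    push Not at this
    obtain ⟨t, ht, htj⟩ := this
    exact ⟨⟨t, ht⟩, htj⟩
  choose g hg using hex
  have hinj : Function.Injective g := fun i j hij => Fin.ext (by rw [← hg i, ← hg j, hij])
  have := Fintype.card_le_of_injective g hinj
  simp only [Fintype.card_fin] at this
  omega

theorem exists_place (h : IsLayout n k A k S L Q U) (i : Fin k) : ∃ t : Fin k, S t = i := by
  have hinj : Function.Injective fun t : Fin k => (⟨S t, h.lt t t.2⟩ : Fin k) := by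
    intro t r htr
    simp only [Fin.mk.injEq] at htr
    exact Fin.ext (h.inj t t.2 r r.2 htr)
  obtain ⟨t, ht⟩ := Finite.surjective_of_injective hinj i
  exact ⟨t, congrArg Fin.val ht⟩

end IsLayout

/-- The table `A` holds the bits of `β` row by row. -/
def HoldsTable {n k : ℕ} (A : ℕ → ℕ) (β : Fin n → Fin k → Bool) : Prop :=
  ∀ (v : Fin n) (i : Fin k), A (v * k + i) = (β v i).toNat

/-- The entry in row `v` and column `c` of the output table of a layout. -/
noncomputable def layoutEntry (k : ℕ) (A S L Q : ℕ → ℕ) (m v c : ℕ) : ℕ :=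
  open Classical in if ∃ t < m, Q t = c ∧ A (v * k + S t) = L t then 1 else 0

/-- Permuting columns, complementing some and adding zero columns changes no Hamming distance; the
links rule out consecutive ones. -/
theorem IsLayout.exists_embedding {n k : ℕ} {A S L Q U : ℕ → ℕ} {G : SimpleGraph (Fin n)}
    {β : Fin n → Fin k → Bool} (h : IsLayout n k A k S L Q U) (hA : HoldsTable A β) (hk : 0 < k)
    (hβ : IsHammingLabelling G β) :
    ∃ φ : Fin n → fibStrings (Q (k - 1) + 1),
      (∀ (v : Fin n) (c : Fin (Q (k - 1) + 1)),
        layoutEntry k A S L Q k v c = ((φ v : Fin _ → Bool) c).toNat) ∧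
      IsIsometricEmbedding G (fibCube _) φ := by
  classical
  have hQ : ∀ t < k, Q t < Q (k - 1) + 1 := fun t ht => by
    rcases Nat.lt_or_ge t (k - 1) with h1 | h1
    · have := h.lt_of_lt h1 (by omega)
      omega
    · obtain rfl : t = k - 1 := by omega
      omega
  refine ⟨fun v => ⟨fun c => decide (∃ t < k, Q t = c ∧ A (v * k + S t) = L t), ?_⟩, ?_, ?_⟩
  · intro c c' hc hcc
    simp only [decide_eq_true_eq] at hcc
    obtain ⟨⟨t, ht, htc, h1⟩, r, hr, hrc, h2⟩ := hcc
    -- Output columns increase strictly along the places, so adjacent ones belong to consecutive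
    -- places.
    have htr : t + 1 = r := by
      rcases Nat.lt_trichotomy (t + 1) r with h3 | h3 | h3
      · have e1 := h.lt_of_lt (Nat.lt_succ_self t) (by omega)
        have e2 := h.lt_of_lt h3 hr
        simp only [Nat.succ_eq_add_one] at e1
        omega
      · exact h3
      · rcases Nat.lt_succ_iff_lt_or_eq.1 h3 with h4 | rfl
        · have := h.lt_of_lt h4 ht
          omega
        · omega
    subst htr
    rcases h.link t hr with h3 | h3
    · exact h3.2 v v.2 ⟨h1, h2⟩
    · omega
  · intro v c
    simp only [layoutEntry]
    by_cases hc : ∃ t < k, Q t = c ∧ A (v * k + S t) = L t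
    · simp [hc]
    · simp [hc]
  · rw [← isHammingLabelling_val_iff]
    intro u v
    rw [hβ u v]
    norm_cast
    have hcol : ∀ (w : Fin n) (t : Fin k),
        (∃ r < k, Q r = Q t ∧ A (w * k + S r) = L r) ↔ A (w * k + S t) = L t := by
      intro w t
      constructor
      · rintro ⟨r, hr, h1, h2⟩
        rwa [h.column_inj hr t.2 h1] at h2
      · exact fun h1 => ⟨t, t.2, rfl, h1⟩
    have hbit : ∀ (t i : Fin k), S t = i →
        ((A (u * k + S t) = L t ↔ A (v * k + S t) = L t) ↔ β u i = β v i) := by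
      intro t i hi
      have := h.bit t t.2
      rw [hi, hA, hA]
      cases β u i <;> cases β v i <;> simp <;> omega
    unfold hammingDist
    choose pl hpl using h.exists_place
    refine Finset.card_bij (fun i _ => ⟨Q (pl i), hQ _ (pl i).2⟩) ?_ ?_ ?_
    · intro i hi
      simp only [Finset.mem_filter, Finset.mem_univ, true_and] at hi ⊢
      simp only [hcol]
      rwa [ne_eq, decide_eq_decide, hbit (pl i) i (hpl i)]
    · intro i _ j _ hij
      simp only [Fin.mk.injEq] at hij
      have := h.column_inj (pl i).2 (pl j).2 hij
      exact Fin.ext (by rw [← hpl i, ← hpl j, this])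
    · intro c hc
      simp only [Finset.mem_filter, Finset.mem_univ, true_and] at hc
      -- Unoccupied output columns are constantly zero, so two rows can differ only in an occupied
      -- one.
      have hex : ∃ t < k, Q t = c := by
        by_contra hno
        push Not at hno
        apply hc
        rw [decide_eq_decide]
        constructor <;> rintro ⟨t, ht, htc, -⟩ <;> exact absurd htc (hno t ht)
      obtain ⟨t, ht, htc⟩ := hex
      have hpt : pl ⟨S t, h.lt t ht⟩ = ⟨t, ht⟩ :=
        Fin.ext (h.inj _ (Fin.is_lt _) t ht (hpl _))
      refine ⟨⟨S t, h.lt t ht⟩, ?_, ?_⟩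
      · simp only [Finset.mem_filter, Finset.mem_univ, true_and]
        simp only [← htc] at hc
        have h1 := hcol u ⟨t, ht⟩
        have h2 := hcol v ⟨t, ht⟩
        simp only at h1 h2
        rw [ne_eq, decide_eq_decide, h1, h2] at hc
        rwa [ne_eq, ← hbit ⟨t, ht⟩ _ rfl]
      · exact Fin.ext (by simp [hpt, htc])

theorem IsLayout.two_mul_le {n k f : ℕ} {A S L Q U : ℕ → ℕ} {G : SimpleGraph (Fin n)}
    {β : Fin n → Fin k → Bool} {ψ : Fin n → fibStrings f} (h : IsLayout n k A k S L Q U)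
    (hA : HoldsTable A β) (hk : 0 < k) (hG : G.Connected) (hβ : IsHammingLabelling G β)
    (hψ : IsIsometricEmbedding G (fibCube f) ψ) (hc : ∀ i, ∃ u v, β u i ≠ β v i) :
    2 * (Q (k - 1) + 1) ≤ 3 * f := by
  classical
  obtain ⟨ι, a, hι, hcut⟩ := hβ.exists_matching_cuts hG (isHammingLabelling_val_iff.2 hψ) hc
  set T := (Finset.range (k - 1)).filter fun t => Q (t + 1) = Q t + 1 with hT
  -- The columns at the left end of a gapless link.
  set N : Finset (Fin k) := Finset.univ.filter fun i => ∃ t ∈ T, S t = i with hN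
  have hcard : N.card ≤ T.card := by
    have : N.image Fin.val ⊆ T.image S := by
      intro x hx
      simp only [hN, Finset.mem_image, Finset.mem_filter, Finset.mem_univ, true_and] at hx ⊢
      obtain ⟨i, ⟨t, ht, hti⟩, rfl⟩ := hx
      exact ⟨t, ht, hti⟩
    rw [← Finset.card_image_of_injective N Fin.val_injective]
    exact (Finset.card_le_card this).trans Finset.card_image_le
  have hQ := h.column_add_card (k - 1) (by omega)
  rw [← hT] at hQ
  have hkf : k ≤ f := by simpa using Fintype.card_le_of_injective _ hι
  have key : 2 * k ≤ f + 1 + 2 * N.card := by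
    refine two_mul_le_of_covered ι hι N fun i j hij => ?_
    by_contra! hno
    obtain ⟨t, ht⟩ := h.exists_place i
    obtain ⟨r, hr⟩ := h.exists_place j
    have hinj : ∀ b c : Bool, b.toNat = c.toNat → b = c := by decide
    -- Adjacent coordinates of a Fibonacci string are never both one, so columns `i` and `j`, signed
    -- as in `ψ`, are disjoint.
    have hd : ColumnsAvoid n k A i (a i).toNat j (a j).toNat := by
      intro v hv hcv
      have e1 := hA ⟨v, hv⟩ i
      have e2 := hA ⟨v, hv⟩ j
      simp only at e1 e2
      rw [e1, e2] at hcv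
      exact (ψ ⟨v, hv⟩).2 (ι i) (ι j) hij
        ⟨(hcut i _).1 (hinj _ _ hcv.1), (hcut j _).1 (hinj _ _ hcv.2)⟩
    have hgap : ∀ (i : Fin k) (t : Fin k), S t = i → i ∉ N → (t : ℕ) + 1 < k →
        ∀ j < k, (∀ r ≤ (t : ℕ), S r ≠ j) → ∀ a ≤ 1, ∀ y ≤ 1,
          ¬ ColumnsAvoid n k A (S t) a j y := by
      intro i t hti hi htk
      rcases h.link t htk with h1 | h1
      · refine absurd ?_ hi
        simp only [hN, hT, Finset.mem_filter, Finset.mem_univ, Finset.mem_range, true_and]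
        exact ⟨t, ⟨by omega, h1.1⟩, hti⟩
      · exact h1.2
    have hbool : ∀ b : Bool, b.toNat ≤ 1 := Bool.toNat_le
    -- The earlier of the two columns is outside `N`, so a gap follows it, and the gap forbids the
    -- disjointness just found.
    rcases lt_trichotomy (t : ℕ) r with h1 | h1 | h1
    · refine hgap i t ht hno.1 (by omega) j j.2 (fun s hs he => ?_) _ (hbool (a i)) _ (hbool (a j))
        (by rw [ht]; exact hd)
      have := h.inj s (by omega) r r.2 (he.trans hr.symm)
      omega
    · have : (i : ℕ) = j := by rw [← ht, ← hr, h1]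
      rw [Fin.ext this] at hij
      omega
    · refine hgap j r hr hno.2 (by omega) i i.2 (fun s hs he => ?_) _ (hbool (a j)) _ (hbool (a i))
        (by rw [hr]; exact hd.symm)
      have := h.inj s (by omega) t t.2 (he.trans ht.symm)
      omega
  -- `2(Q (k - 1) + 1) = 4k - 2 - 2|T| ≤ 2k + f - 1 ≤ 3f - 1`, using `|N| ≤ |T|` and `k ≤ f`.
  omega

/-- If the bound failed at `d = fdim G`, every admissible dimension would be at least `d + 1`,
contradicting the infimum. -/
theorem two_mul_le_three_mul_fdim {V : Type*} {G : SimpleGraph V} {m : ℕ}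
    (h : ∀ f, 1 ≤ f → ∀ ψ : V → fibStrings f, IsIsometricEmbedding G (fibCube f) ψ →
      2 * m ≤ 3 * f) : 2 * (m : ℕ∞) ≤ 3 * fdim G := by
  cases hf : fdim G with
  | top => simp [ENat.mul_top]
  | coe d =>
    by_contra! hlt
    norm_cast at hlt
    have : ((d + 1 : ℕ) : ℕ∞) ≤ fdim G := by
      refine le_iInf₂ fun f hψ => ?_
      obtain ⟨h1, ψ, hψ⟩ := hψ
      have h2 : (d : ℕ∞) ≤ f := by
        rw [← hf]
        exact iInf₂_le f ⟨h1, ψ, hψ⟩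
      have := h f h1 ψ hψ
      norm_cast at h2 ⊢
      omega
    rw [hf] at this
    norm_cast at this
    omega

/-! ### Verification rules for the machine -/

namespace RamState

variable (s : RamState) (r A p x : ℕ)

@[simp] theorem reg_setReg (r' : ℕ) : (s.setReg r x).reg r' = if r' = r then x else s.reg r' := by
  simp [setReg, Function.update_apply]

@[simp] theorem arr_setReg : (s.setReg r x).arr = s.arr := rfl

@[simp] theorem reg_setArr : (s.setArr A p x).reg = s.reg := rfl

@[simp] theorem arr_setArr (A' : ℕ) :
    (s.setArr A p x).arr A' = if A' = A then Function.update (s.arr A) p x else s.arr A' := by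
  simp [setArr, Function.update_apply]

end RamState

/-- Started in `s`, the program `P` halts within `T` steps in a state that satisfies `Q`. -/
def Runs (W : ℕ) (P : RamProg) (s : RamState) (T : ℕ) (Q : RamState → Prop) : Prop :=
  ∃ t s', RamExec W P s t s' ∧ t ≤ T ∧ Q s'

namespace Runs

variable {W T T₁ T₂ r a b p A x : ℕ} {P P' : RamProg} {s : RamState} {Q R : RamState → Prop}

theorem mono (h : Runs W P s T₁ R) (hT : T₁ ≤ T) (hQ : ∀ s', R s' → Q s') : Runs W P s T Q := by
  obtain ⟨t, s', h1, h2, h3⟩ := h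
  exact ⟨t, s', h1, h2.trans hT, hQ s' h3⟩

theorem last (hT : 1 ≤ T) (h : Runs W P s 1 Q) : Runs W P s T Q := h.mono hT fun _ h => h

theorem seq (h : Runs W P s T₁ R) (hT : T₁ ≤ T) (h' : ∀ s', R s' → Runs W P' s' (T - T₁) Q) :
    Runs W (P.seq P') s T Q := by
  obtain ⟨t, s', h1, h2, h3⟩ := h
  obtain ⟨t', s'', h4, h5, h6⟩ := h' s' h3
  exact ⟨t + t', s'', .seq h1 h4, by omega, h6⟩

theorem step (hT : 1 ≤ T) (h : Runs W P s 1 fun s' => Runs W P' s' (T - 1) Q) :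
    Runs W (P.seq P') s T Q :=
  h.seq hT fun _ h => h

theorem skip (h : Q s) : Runs W .skip s 1 Q := ⟨1, s, .skip s, le_rfl, h⟩

theorem const (hx : x < W) (h : Q (s.setReg r x)) : Runs W (.const r x) s 1 Q :=
  ⟨1, _, .const s r x hx, le_rfl, h⟩

theorem add (hx : s.reg a + s.reg b < W) (h : Q (s.setReg r (s.reg a + s.reg b))) :
    Runs W (.add r a b) s 1 Q :=
  ⟨1, _, .add s r a b hx, le_rfl, h⟩

theorem sub (hx : s.reg a - s.reg b < W) (h : Q (s.setReg r (s.reg a - s.reg b))) :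
    Runs W (.sub r a b) s 1 Q :=
  ⟨1, _, .sub s r a b hx, le_rfl, h⟩

theorem mul (hx : s.reg a * s.reg b < W) (h : Q (s.setReg r (s.reg a * s.reg b))) :
    Runs W (.mul r a b) s 1 Q :=
  ⟨1, _, .mul s r a b hx, le_rfl, h⟩

theorem load (hx : s.arr A (s.reg p) < W) (h : Q (s.setReg r (s.arr A (s.reg p)))) :
    Runs W (.load r A p) s 1 Q :=
  ⟨1, _, .load s r A p hx, le_rfl, h⟩

theorem store (hx : s.reg a < W) (h : Q (s.setArr A (s.reg p) (s.reg a))) :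
    Runs W (.store A p a) s 1 Q :=
  ⟨1, _, .store s A p a hx, le_rfl, h⟩

theorem ite (hT : 1 ≤ T) (ht : s.reg a < s.reg b → Runs W P s (T - 1) Q)
    (hf : ¬ s.reg a < s.reg b → Runs W P' s (T - 1) Q) : Runs W (.ite a b P P') s T Q := by
  by_cases h : s.reg a < s.reg b
  · obtain ⟨t, s', h1, h2, h3⟩ := ht h
    exact ⟨t + 1, s', .ite_true h h1, by omega, h3⟩
  · obtain ⟨t, s', h1, h2, h3⟩ := hf h
    exact ⟨t + 1, s', .ite_false h h1, by omega, h3⟩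

/-- The invariant is indexed by the number of completed rounds, so invariant, exact round count and
time bound come from one induction. -/
theorem loop (I : ℕ → RamState → Prop) (N : ℕ)
    (hstep : ∀ x < N, ∀ s, I x s → s.reg a < s.reg b ∧ Runs W P s T (I (x + 1)))
    (hend : ∀ s, I N s → ¬ s.reg a < s.reg b) (h0 : I 0 s) :
    Runs W (.loop a b P) s (N * (T + 1) + 1) (I N) := by
  have key : ∀ d x s, x + d = N → I x s → Runs W (.loop a b P) s (d * (T + 1) + 1) (I N) := by
    intro d
    induction d with
    | zero =>
      rintro x s rfl hx
      exact ⟨1, s, .loop_done (hend s hx), by omega, hx⟩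
    | succ d ih =>
      intro x s hxd hx
      obtain ⟨hlt, t, s', h1, h2, h3⟩ := hstep x (by omega) s hx
      obtain ⟨t', s'', h4, h5, h6⟩ := ih (x + 1) s' (by omega) h3
      refine ⟨t + t' + 1, s'', .loop_step hlt h1 h4, ?_, h6⟩
      have : (d + 1) * (T + 1) = d * (T + 1) + (T + 1) := by ring
      omega
  exact key N 0 s (by omega) h0

end Runs

/-! ### The program

Registers: `0` is `n`, `1` is `k`, `2` is the constant one, `3` the number of placed columns, `4` the
last output column in use; `5` and `6` are the last placed column and its sign; `7` is some unused
column; `8` tells whether an unused column disjoint from the last one was found, and then `10` is the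
sign of the last column, `9` and `11` are the new column and its sign. Arrays: `0` is the input, `1`
the output, `2`, `3`, `4` and `5` are `S`, `L`, `Q` and `U` of `IsLayout`, and `6` holds marks. -/

namespace FibProg

/-- Mark in array `6` the pair of bits of row `13` in columns `5` and `12`. -/
def markLoopBody : RamProg :=
  .seq (.mul 14 13 1) <| .seq (.add 15 14 5) <| .seq (.load 15 0 15) <| .seq (.add 15 15 15) <|
  .seq (.add 14 14 12) <| .seq (.load 14 0 14) <| .seq (.add 14 15 14) <| .seq (.store 6 14 2) <|
  .add 13 13 2

/-- Mark in array `6` the pairs of bits that occur in columns `5` and `12`. -/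
def markPairs : RamProg :=
  .seq (.const 13 0) <|
  .seq (.const 14 0) <| .seq (.store 6 14 13) <| .seq (.const 14 1) <| .seq (.store 6 14 13) <|
  .seq (.const 14 2) <| .seq (.store 6 14 13) <| .seq (.const 14 3) <| .seq (.store 6 14 13) <|
  .loop 13 0 markLoopBody

/-- Record column `12` with sign `y` if the pair of bits `a`, `y` has no mark. -/
def checkPair (a y : ℕ) : RamProg :=
  .seq (.const 14 (a + a + y)) <| .seq (.load 14 6 14) <|
  .ite 14 2
    -- Register `14` holds zero in this branch, so the addition is a copy; other copies in the
    -- program use a zero register in the same way.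
    (.seq (.const 8 1) <| .seq (.add 9 12 14) <| .seq (.const 10 a) <| .const 11 y)
    .skip

/-- Try all four pairs of signs for the unused column `12`. -/
def tryColumn : RamProg :=
  .seq (.add 7 12 14) <| .seq markPairs <| .seq (checkPair 0 0) <| .seq (checkPair 0 1) <|
  .seq (checkPair 1 0) (checkPair 1 1)

/-- Examine column `12` if it is unused, and go to the next one. -/
def scanBody : RamProg :=
  .seq (.load 14 5 12) <| .seq (.ite 14 2 tryColumn .skip) (.add 12 12 2)

/-- Search an unused column disjoint from column `5`. -/
def scan : RamProg :=
  .seq (.const 8 0) <| .seq (.const 12 0) <| .loop 12 1 scanBody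

/-- Place an unused column after a gap. -/
def placeGap : RamProg :=
  -- Register `8` is zero in this branch and supplies the sign; after a gap either sign would do.
  .seq (.store 2 3 7) <| .seq (.store 3 3 8) <| .seq (.store 5 7 2) <| .seq (.add 4 4 2) <|
  .seq (.add 4 4 2) <| .seq (.store 4 3 4) <| .add 3 3 2

/-- Place the column found by the scan, next to last if the last column has the wrong sign. -/
def placeFound : RamProg :=
  .seq (.store 5 9 2) <| .seq (.add 4 4 2) <| .seq (.store 4 3 4) <|
  -- The two truncated differences add up to the absolute difference, zero exactly when the last
  -- column already has the required sign.
  .seq (.sub 14 6 10) <| .seq (.sub 15 10 6) <| .seq (.add 14 14 15) <|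
  .ite 14 2
    (.seq (.store 2 3 9) <| .seq (.store 3 3 11) <| .add 3 3 2)
    (.seq (.store 2 3 5) <| .seq (.store 3 3 10) <| .seq (.sub 14 3 2) <|
      .seq (.store 2 14 9) <| .seq (.store 3 14 11) <| .add 3 3 2)

/-- Place one more column. -/
def placeColumn : RamProg :=
  .seq (.sub 14 3 2) <| .seq (.load 5 2 14) <| .seq (.load 6 3 14) <| .seq scan <|
  .ite 8 2 placeGap placeFound

/-- Write the entry of row `5` and place `8`. -/
def writeEntry : RamProg :=
  .seq (.load 9 2 8) <| .seq (.add 9 6 9) <| .seq (.load 9 0 9) <| .seq (.load 10 3 8) <|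
  -- The entry is one minus the absolute difference of bit and sign.
  .seq (.load 11 4 8) <| .seq (.add 11 7 11) <| .seq (.sub 12 9 10) <| .seq (.sub 13 10 9) <|
  .seq (.add 12 12 13) <| .seq (.sub 12 2 12) <| .seq (.store 1 11 12) <| .add 8 8 2

/-- Write row `5` of the output. -/
def writeRow : RamProg :=
  .seq (.mul 6 5 1) <| .seq (.mul 7 5 4) <| .seq (.const 8 0) <| .seq (.loop 8 1 writeEntry) <|
  .add 5 5 2

/-- Write the output. -/
def writeTable : RamProg :=
  .seq (.add 4 4 2) <| .seq (.const 5 0) <| .seq (.loop 5 0 writeRow) <|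
  .seq (.const 8 0) <| .add 0 4 8

/-- The whole program. -/
def main : RamProg :=
  .seq (.const 2 1) <|
  .ite 1 2 (.const 0 1) <|
  .seq (.const 3 1) <| .seq (.const 14 0) <| .seq (.store 5 14 2) <|
  .seq (.loop 3 1 placeColumn) writeTable

/-! ### Correctness and running time of the search and of the placement steps -/

variable {W n k : ℕ} {A U : ℕ → ℕ} {s : RamState}

theorem index_lt (hW : 4 * ((n + 1) * (k + 1)) ≤ W) {v i : ℕ} (hv : v < n) (hi : i < k) :
    v * k + i < W := by
  nlinarith

theorem runs_markPairs (hW : 4 * ((n + 1) * (k + 1)) ≤ W) (hA : ∀ c, A c ≤ 1)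
    (h0 : s.reg 0 = n) (h1 : s.reg 1 = k) (h2 : s.reg 2 = 1) (hi : s.reg 5 < k) (hj : s.reg 12 < k)
    (hA0 : s.arr 0 = A) :
    Runs W markPairs s (n * 10 + 10) fun s' =>
      (∀ r < 13, s'.reg r = s.reg r) ∧ (∀ a < 6, s'.arr a = s.arr a) ∧
      ∀ a ≤ 1, ∀ y ≤ 1, s'.arr 6 (a + a + y) ≤ 1 ∧
        (s'.arr 6 (a + a + y) < 1 ↔ ColumnsAvoid n k A (s.reg 5) a (s.reg 12) y) := by
  have hW4 : 4 ≤ W := by nlinarith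
  have hnW : n < W := by nlinarith
  refine .step (by omega) (.const (by omega) ?_)
  refine .step (by omega) (.const (by omega) ?_)
  refine .step (by omega) (.store (by simp; omega) ?_)
  refine .step (by omega) (.const (by omega) ?_)
  refine .step (by omega) (.store (by simp; omega) ?_)
  refine .step (by omega) (.const (by omega) ?_)
  refine .step (by omega) (.store (by simp; omega) ?_)
  refine .step (by omega) (.const (by omega) ?_)
  refine .step (by omega) (.store (by simp; omega) ?_)
  refine (Runs.loop (T := 9) (fun x s' => s'.reg 13 = x ∧ (∀ r < 13, s'.reg r = s.reg r) ∧
    (∀ a < 6, s'.arr a = s.arr a) ∧ ∀ a ≤ 1, ∀ y ≤ 1, s'.arr 6 (a + a + y) ≤ 1 ∧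
      (s'.arr 6 (a + a + y) < 1 ↔
        ∀ v < x, ¬ (A (v * k + s.reg 5) = a ∧ A (v * k + s.reg 12) = y))) n ?_ ?_ ?_).mono
    (by omega) fun s' h => h.2
  · rintro x hx s' ⟨hx', hreg, harr, hmark⟩
    have e0 : s'.reg 0 = n := by rw [hreg 0 (by omega), h0]
    have e1 : s'.reg 1 = k := by rw [hreg 1 (by omega), h1]
    have e2 : s'.reg 2 = 1 := by rw [hreg 2 (by omega), h2]
    have e5 := hreg 5 (by omega)
    have e12 := hreg 12 (by omega)
    have eA : s'.arr 0 = A := by rw [harr 0 (by omega), hA0]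
    have b1 := index_lt hW hx hi
    have b2 := index_lt hW hx hj
    have a1 := hA (x * k + s.reg 5)
    have a2 := hA (x * k + s.reg 12)
    refine ⟨by omega, ?_⟩
    refine .step (by omega) (.mul (by simp [hx', e1]; omega) ?_)
    refine .step (by omega) (.add (by simp [hx', e1, e5]; omega) ?_)
    refine .step (by omega) (.load (by simp [hx', e1, e5, eA]; omega) ?_)
    refine .step (by omega) (.add (by simp [hx', e1, e5, eA]; omega) ?_)
    refine .step (by omega) (.add (by simp [hx', e1, e12]; omega) ?_)
    refine .step (by omega) (.load (by simp [hx', e1, e12, eA]; omega) ?_)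
    refine .step (by omega) (.add (by simp [hx', e1, e5, e12, eA]; omega) ?_)
    refine .step (by omega) (.store (by simp [e2]; omega) ?_)
    refine .last (by omega) (.add (by simp [e2, hx']; omega) ⟨?_, ?_, ?_, ?_⟩)
    · simp [e2, hx']
    · intro r hr
      simp [hreg r hr, show r ≠ 13 by omega, show r ≠ 14 by omega, show r ≠ 15 by omega]
    · intro a ha
      simp [harr a ha, show a ≠ 6 by omega]
    · intro a ha y hy
      simp only [RamState.arr_setReg, RamState.arr_setArr, RamState.reg_setReg, if_true, hx', e1, e2,
        e5, e12, eA, Function.update_apply]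
      norm_num [hx', e1, e2, e5, e12, eA]
      obtain ⟨hb, hm⟩ := hmark a ha y hy
      simp only [Nat.lt_one_iff, not_and] at hm
      have hsplit : (∀ v ≤ x, A (v * k + s.reg 5) = a → ¬ A (v * k + s.reg 12) = y) ↔
          (∀ v < x, A (v * k + s.reg 5) = a → ¬ A (v * k + s.reg 12) = y) ∧
            (A (x * k + s.reg 5) = a → ¬ A (x * k + s.reg 12) = y) := by
        simp only [← Nat.lt_succ_iff, Nat.succ_eq_add_one]
        exact Nat.forall_lt_succ_right
      rw [hsplit, ← hm]
      -- For bits, the cell number `2a + y` determines the pair, so row `x` marks this cell exactly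
      -- when it shows `(a, y)`.
      by_cases hc : A (x * k + s.reg 5) = a ∧ A (x * k + s.reg 12) = y
      · rw [if_pos (by omega)]
        simp [hc]
      · rw [if_neg (by omega)]
        exact ⟨hb, fun h => ⟨h, fun p q => hc ⟨p, q⟩⟩, fun h => h.1⟩
  · rintro s' ⟨hx', hreg, -, -⟩
    have := hreg 0 (by omega)
    omega
  · refine ⟨by simp, ?_, ?_, ?_⟩
    · intro r hr
      simp [show r ≠ 13 by omega, show r ≠ 14 by omega]
    · intro a ha
      simp [show a ≠ 6 by omega]
    · intro a ha y hy
      interval_cases a <;> interval_cases y <;> simp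

/-- Either nothing was found, or registers `9`, `10`, `11` describe an unused column `9` disjoint
from column `i`. -/
def FoundValid (n k : ℕ) (A U : ℕ → ℕ) (i : ℕ) (s : RamState) : Prop :=
  s.reg 8 < 1 ∨ (s.reg 9 < k ∧ U (s.reg 9) < 1 ∧ s.reg 10 ≤ 1 ∧ s.reg 11 ≤ 1 ∧
    ColumnsAvoid n k A i (s.reg 10) (s.reg 9) (s.reg 11))

/-- A later hit may overwrite an earlier one, since any valid find is good enough; a flag that is
still zero certifies that every test so far failed. -/
theorem runs_checkPair (hW4 : 4 ≤ W) (hkW : k < W) {i a y : ℕ} (ha : a ≤ 1) (hy : y ≤ 1)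
    (h2 : s.reg 2 = 1) (hj : s.reg 12 < k) (hU : U (s.reg 12) < 1) (hF : FoundValid n k A U i s)
    (hm : ∀ a ≤ 1, ∀ y ≤ 1, s.arr 6 (a + a + y) ≤ 1 ∧
      (s.arr 6 (a + a + y) < 1 ↔ ColumnsAvoid n k A i a (s.reg 12) y)) :
    Runs W (checkPair a y) s 7 fun s' =>
      (∀ r < 8, s'.reg r = s.reg r) ∧ s'.reg 12 = s.reg 12 ∧ s'.arr = s.arr ∧
      FoundValid n k A U i s' ∧
      (s'.reg 8 < 1 → s.reg 8 < 1 ∧ ¬ ColumnsAvoid n k A i a (s.reg 12) y) := by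
  obtain ⟨hb, hm'⟩ := hm a ha y hy
  refine .step (by omega) (.const (by omega) ?_)
  refine .step (by omega) (.load (by simp; omega) ?_)
  refine .ite (by omega) (fun h => ?_) (fun h => ?_)
  · simp only [RamState.reg_setReg, RamState.arr_setReg, if_true] at h
    norm_num [h2] at h
    have hd : ColumnsAvoid n k A i a (s.reg 12) y := hm'.1 (by omega)
    refine .step (by omega) (.const (by omega) ?_)
    refine .step (by omega) (.add (by simp [h]; omega) ?_)
    refine .step (by omega) (.const (by omega) ?_)
    refine .last (by omega) (.const (by omega) ⟨?_, ?_, ?_, ?_, ?_⟩)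
    · intro r hr
      simp [show r ≠ 8 by omega, show r ≠ 9 by omega, show r ≠ 10 by omega, show r ≠ 11 by omega,
        show r ≠ 14 by omega]
    · simp
    · simp
    · right
      simp [h, hj, hU, ha, hy, hd]
    · simp
  · simp only [RamState.reg_setReg, RamState.arr_setReg, if_true] at h
    norm_num [h2] at h
    refine .last (by omega) (.skip ⟨?_, ?_, ?_, ?_, ?_⟩)
    · intro r hr
      simp [show r ≠ 14 by omega]
    · simp
    · simp
    · simpa [FoundValid] using hF
    · intro h8
      refine ⟨by simpa using h8, fun hd => ?_⟩
      have := hm'.2 hd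
      omega

theorem runs_tryColumn (hW : 4 * ((n + 1) * (k + 1)) ≤ W) (hA : ∀ c, A c ≤ 1)
    (h0 : s.reg 0 = n) (h1 : s.reg 1 = k) (h2 : s.reg 2 = 1) (hi : s.reg 5 < k) (hj : s.reg 12 < k)
    (hA0 : s.arr 0 = A) (hU : U (s.reg 12) < 1) (h14 : s.reg 14 = 0)
    (hF : FoundValid n k A U (s.reg 5) s) :
    Runs W tryColumn s (n * 10 + 40) fun s' =>
      (∀ r < 7, s'.reg r = s.reg r) ∧ s'.reg 7 = s.reg 12 ∧ s'.reg 12 = s.reg 12 ∧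
      (∀ a < 6, s'.arr a = s.arr a) ∧ FoundValid n k A U (s.reg 5) s' ∧
      (s'.reg 8 < 1 → s.reg 8 < 1 ∧ ∀ a ≤ 1, ∀ y ≤ 1,
        ¬ ColumnsAvoid n k A (s.reg 5) a (s.reg 12) y) := by
  have hW4 : 4 ≤ W := by nlinarith
  have hkW : k < W := by nlinarith
  refine .step (by omega) (.add (by simp [h14]; omega) ?_)
  refine (runs_markPairs hW hA (by simpa using h0) (by simpa using h1) (by simpa using h2)
    (by simpa using hi) (by simpa using hj) (by simpa using hA0)).seq (by omega) ?_
  rintro s₁ ⟨hreg, harr, hm⟩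
  simp only [RamState.reg_setReg, RamState.arr_setReg] at hreg harr hm
  norm_num at hm
  have f7 := hreg 7 (by omega)
  have f8 := hreg 8 (by omega)
  have f9 := hreg 9 (by omega)
  have f10 := hreg 10 (by omega)
  have f11 := hreg 11 (by omega)
  have f12 := hreg 12 (by omega)
  have f2 := hreg 2 (by omega)
  norm_num [h14] at f2 f7 f8 f9 f10 f11 f12
  have hF₁ : FoundValid n k A U (s.reg 5) s₁ := by
    unfold FoundValid at hF ⊢
    rwa [f8, f9, f10, f11]
  have hm₁ : ∀ a ≤ 1, ∀ y ≤ 1, s₁.arr 6 (a + a + y) ≤ 1 ∧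
      (s₁.arr 6 (a + a + y) < 1 ↔ ColumnsAvoid n k A (s.reg 5) a (s.reg 12) y) := by
    simpa using hm
  clear hm
  refine (runs_checkPair (a := 0) (y := 0) hW4 hkW (by omega) (by omega) (f2.trans h2)
    (by omega) (by rwa [f12]) hF₁ (by rwa [f12])).seq (by omega) ?_
  rintro s₂ ⟨g₂, j₂, m₂, F₂, c₂⟩
  refine (runs_checkPair (a := 0) (y := 1) hW4 hkW (by omega) (by omega)
    (by rw [g₂ 2 (by omega), f2, h2]) (by omega) (by rwa [j₂, f12]) F₂
    (by rwa [j₂, f12, m₂])).seq (by omega) ?_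
  rintro s₃ ⟨g₃, j₃, m₃, F₃, c₃⟩
  refine (runs_checkPair (a := 1) (y := 0) hW4 hkW (by omega) (by omega)
    (by rw [g₃ 2 (by omega), g₂ 2 (by omega), f2, h2]) (by omega) (by rwa [j₃, j₂, f12]) F₃
    (by rwa [j₃, j₂, f12, m₃, m₂])).seq (by omega) ?_
  rintro s₄ ⟨g₄, j₄, m₄, F₄, c₄⟩
  refine (runs_checkPair (a := 1) (y := 1) hW4 hkW (by omega) (by omega)
    (by rw [g₄ 2 (by omega), g₃ 2 (by omega), g₂ 2 (by omega), f2, h2]) (by omega)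
    (by rwa [j₄, j₃, j₂, f12]) F₄ (by rwa [j₄, j₃, j₂, f12, m₄, m₃, m₂])).mono (by omega) ?_
  rintro s₅ ⟨g₅, j₅, m₅, F₅, c₅⟩
  rw [j₄, j₃, j₂, f12] at c₅
  rw [j₃, j₂, f12] at c₄
  rw [j₂, f12] at c₃
  rw [f12] at c₂
  refine ⟨fun r hr => ?_, ?_, ?_, fun a ha => ?_, F₅, fun h => ?_⟩
  · rw [g₅ r (by omega), g₄ r (by omega), g₃ r (by omega), g₂ r (by omega), hreg r (by omega),
      if_neg (by omega)]
  · rw [g₅ 7 (by omega), g₄ 7 (by omega), g₃ 7 (by omega), g₂ 7 (by omega), f7]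
  · rw [j₅, j₄, j₃, j₂, f12]
  · rw [m₅, m₄, m₃, m₂, harr a ha]
  · obtain ⟨h₅, d₅⟩ := c₅ h
    obtain ⟨h₄, d₄⟩ := c₄ h₅
    obtain ⟨h₃, d₃⟩ := c₃ h₄
    obtain ⟨h₂, d₂⟩ := c₂ h₃
    refine ⟨by omega, fun a ha y hy => ?_⟩
    interval_cases a <;> interval_cases y <;> assumption

/-- Register `7` is guaranteed meaningful only after an unused column has been passed, so the
invariant is conditional there; `hex` discharges the condition at the end. -/
theorem runs_scan (hW : 4 * ((n + 1) * (k + 1)) ≤ W) (hA : ∀ c, A c ≤ 1)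
    (h0 : s.reg 0 = n) (h1 : s.reg 1 = k) (h2 : s.reg 2 = 1) (hi : s.reg 5 < k)
    (hA0 : s.arr 0 = A) (hA5 : s.arr 5 = U) (hU : ∀ j < k, U j ≤ 1) (hex : ∃ j < k, U j < 1) :
    Runs W scan s (k * (n * 10 + 46) + 4) fun s' =>
      (∀ r < 7, s'.reg r = s.reg r) ∧ (∀ a < 6, s'.arr a = s.arr a) ∧
      s'.reg 7 < k ∧ U (s'.reg 7) < 1 ∧ FoundValid n k A U (s.reg 5) s' ∧
      (s'.reg 8 < 1 → ∀ j < k, U j < 1 → ∀ a ≤ 1, ∀ y ≤ 1,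
        ¬ ColumnsAvoid n k A (s.reg 5) a j y) := by
  have hW4 : 4 ≤ W := by nlinarith
  have hkW : k < W := by nlinarith
  refine .step (by omega) (.const (by omega) ?_)
  refine .step (by omega) (.const (by omega) ?_)
  refine (Runs.loop (T := n * 10 + 45) (fun x s' => s'.reg 12 = x ∧ (∀ r < 7, s'.reg r = s.reg r) ∧
    (∀ a < 6, s'.arr a = s.arr a) ∧ ((∃ j < x, U j < 1) → s'.reg 7 < k ∧ U (s'.reg 7) < 1) ∧
    FoundValid n k A U (s.reg 5) s' ∧ (s'.reg 8 < 1 → ∀ j < x, U j < 1 → ∀ a ≤ 1, ∀ y ≤ 1,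
      ¬ ColumnsAvoid n k A (s.reg 5) a j y)) k ?_ ?_ ?_).mono (by simp) ?_
  · rintro x hx s₁ ⟨hx₁, hreg, harr, hex₁, hF, hno⟩
    have e5 := hreg 5 (by omega)
    have eU : s₁.arr 5 = U := by rw [harr 5 (by omega), hA5]
    have hUx := hU x hx
    refine ⟨by rw [hreg 1 (by omega)]; omega, ?_⟩
    refine .step (by omega) (.load (by simp [hx₁, eU]; omega) ?_)
    refine Runs.seq (T₁ := n * 10 + 41) (R := fun s' => s'.reg 12 = x ∧
      (∀ r < 7, s'.reg r = s.reg r) ∧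
      (∀ a < 6, s'.arr a = s.arr a) ∧ ((∃ j < x + 1, U j < 1) → s'.reg 7 < k ∧ U (s'.reg 7) < 1) ∧
      FoundValid n k A U (s.reg 5) s' ∧ (s'.reg 8 < 1 → ∀ j < x + 1, U j < 1 →
        ∀ a ≤ 1, ∀ y ≤ 1, ¬ ColumnsAvoid n k A (s.reg 5) a j y)) ?_ (by omega) ?_
    · refine .ite (by omega) (fun h => ?_) (fun h => ?_)
      · simp [hx₁, eU, hreg 2 (by omega), h2] at h
        refine (runs_tryColumn (U := U) hW hA (by simp [hreg, h0]) (by simp [hreg, h1])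
          (by simp [hreg, h2]) (by simpa [hreg] using hi) (by simp [hx₁, hx]) (by simp [harr, hA0])
          (by simp [hx₁, h]) (by simp [hx₁, eU, h])
          (by simpa [FoundValid, hreg] using hF)).mono (by omega) ?_
        rintro s₂ ⟨g₂, r7, r12, m₂, F₂, c₂⟩
        simp only [RamState.reg_setReg, RamState.arr_setReg] at g₂ r7 r12 m₂ F₂ c₂
        norm_num [hx₁, e5] at r7 r12 F₂ c₂
        refine ⟨r12, fun r hr => ?_, fun a ha => ?_, fun _ => ?_, F₂, fun h8 => ?_⟩
        · rw [g₂ r hr, if_neg (by omega), hreg r hr]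
        · rw [m₂ a ha, harr a ha]
        · rw [r7]
          exact ⟨hx, by omega⟩
        · obtain ⟨h8', hnew⟩ := c₂ (by omega)
          intro j hj hUj
          rcases Nat.lt_succ_iff_lt_or_eq.1 hj with h3 | rfl
          · exact hno (by omega) j h3 hUj
          · exact hnew
      · simp [hx₁, eU, hreg 2 (by omega), h2] at h
        refine .last (by omega) (.skip ⟨by simpa using hx₁, fun r hr => ?_, by simpa using harr,
          fun hj => ?_, by simpa [FoundValid] using hF, fun h8 j hj hUj => ?_⟩)
        · simp [show r ≠ 14 by omega, hreg r hr]
        · obtain ⟨j, hj, hUj⟩ := hj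
          rcases Nat.lt_succ_iff_lt_or_eq.1 hj with h3 | rfl
          · simpa using hex₁ ⟨j, h3, hUj⟩
          · omega
        · rcases Nat.lt_succ_iff_lt_or_eq.1 hj with h3 | rfl
          · exact hno (by simpa using h8) j h3 hUj
          · omega
    · rintro s₂ ⟨g12, g₂, m₂, ex₂, F₂, c₂⟩
      refine .last (by omega) (.add (by rw [g12, g₂ 2 (by omega), h2]; omega)
        ⟨?_, fun r hr => ?_, by simpa using m₂, by simpa using ex₂,
          by simpa [FoundValid] using F₂, by simpa using c₂⟩)
      · simp [g12, g₂ 2, h2]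
      · simp [show r ≠ 12 by omega, g₂ r hr]
  · rintro s' ⟨hx', hreg, -⟩
    rw [hx', hreg 1 (by omega), h1]
    omega
  · refine ⟨by simp, fun r hr => ?_, by simp, by simp, Or.inl (by simp), by simp⟩
    simp [show r ≠ 8 by omega, show r ≠ 12 by omega]
  · rintro s' ⟨-, hreg, harr, h7, hF, hno⟩
    exact ⟨hreg, harr, (h7 hex).1, (h7 hex).2, hF, hno⟩

/-- The machine state after `p + 1` columns have been placed. -/
structure PlaceInv (n k : ℕ) (A : ℕ → ℕ) (p : ℕ) (s : RamState) : Prop where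
  reg_n : s.reg 0 = n
  reg_k : s.reg 1 = k
  reg_one : s.reg 2 = 1
  reg_count : s.reg 3 = p + 1
  reg_column : s.reg 4 = s.arr 4 p
  input : s.arr 0 = A
  output : ∀ c, s.arr 1 c = 0
  used_le : ∀ j, s.arr 5 j ≤ 1
  layout : IsLayout n k A (p + 1) (s.arr 2) (s.arr 3) (s.arr 4) (s.arr 5)

theorem update_le_one {V : ℕ → ℕ} (hV : ∀ j, V j ≤ 1) (i j : ℕ) : Function.update V i 1 j ≤ 1 := by
  rw [Function.update_apply]
  split_ifs
  · exact le_rfl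
  · exact hV j

theorem runs_placeGap (hW : 4 * ((n + 1) * (k + 1)) ≤ W) {p : ℕ} (hp : p + 1 < k)
    (h : PlaceInv n k A p s) (h7 : s.reg 7 < k) (hU : s.arr 5 (s.reg 7) < 1) (h8 : s.reg 8 < 1)
    (hno : ∀ j < k, s.arr 5 j < 1 → ∀ a ≤ 1, ∀ y ≤ 1,
      ¬ ColumnsAvoid n k A (s.arr 2 p) a j y) :
    Runs W placeGap s 7 (PlaceInv n k A (p + 1)) := by
  have hW4 : 4 * (k + 1) ≤ W := by nlinarith
  have hq := h.layout.column_le p (by omega)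
  have h8' : s.reg 8 = 0 := by omega
  obtain ⟨r0, r1, r2, r3, r4, a0, a1, ub, lay⟩ := h
  have key := lay.snoc h7 hU (y := 0) (by omega) (Or.inr ⟨rfl, hno⟩)
  refine .step (by omega) (.store (by omega) ?_)
  refine .step (by omega) (.store (by simp; omega) ?_)
  refine .step (by omega) (.store (by simp; omega) ?_)
  refine .step (by omega) (.add (by simp [r4, r2]; omega) ?_)
  refine .step (by omega) (.add (by simp [r4, r2]; omega) ?_)
  refine .step (by omega) (.store (by simp [r4, r2]; omega) ?_)
  refine .last (by omega) (.add (by simp [r3, r2]; omega) ?_)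
  constructor
  · simpa using r0
  · simpa using r1
  · simpa using r2
  · simp [r3, r2]
  · simp [r3, r2, r4]
  · simpa using a0
  · simpa using a1
  · simpa [r2] using update_le_one ub _
  · simpa [r2, r3, r4, h8', add_assoc] using key

theorem runs_placeFound (hW : 4 * ((n + 1) * (k + 1)) ≤ W) (hA : ∀ c, A c ≤ 1) {p : ℕ}
    (hp : p + 1 < k) (h : PlaceInv n k A p s) (h5 : s.reg 5 = s.arr 2 p) (h6 : s.reg 6 = s.arr 3 p)
    (h9 : s.reg 9 < k) (hU : s.arr 5 (s.reg 9) < 1) (h10 : s.reg 10 ≤ 1) (h11 : s.reg 11 ≤ 1)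
    (hd : ColumnsAvoid n k A (s.arr 2 p) (s.reg 10) (s.reg 9) (s.reg 11)) :
    Runs W placeFound s 13 (PlaceInv n k A (p + 1)) := by
  have hW4 : 4 * (k + 1) ≤ W := by nlinarith
  have hq := h.layout.column_le p (by omega)
  have hL := h.layout.bit p (by omega)
  have hS := h.layout.lt p (by omega)
  obtain ⟨r0, r1, r2, r3, r4, a0, a1, ub, lay⟩ := h
  refine .step (by omega) (.store (by omega) ?_)
  refine .step (by omega) (.add (by simp [r4, r2]; omega) ?_)
  refine .step (by omega) (.store (by simp [r4, r2]; omega) ?_)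
  refine .step (by omega) (.sub (by simp [h6]; omega) ?_)
  refine .step (by omega) (.sub (by simp [h6]; omega) ?_)
  refine .step (by omega) (.add (by simp [h6]; omega) ?_)
  refine .ite (by omega) (fun hlt => ?_) (fun hlt => ?_)
  · simp [r2, h6] at hlt
    have he : s.reg 10 = s.arr 3 p := by omega
    have key := lay.snoc h9 hU h11 (Or.inl ⟨rfl, he ▸ hd⟩)
    refine .step (by omega) (.store (by simp; omega) ?_)
    refine .step (by omega) (.store (by simp; omega) ?_)
    refine .last (by omega) (.add (by simp [r3, r2]; omega) ?_)
    constructor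
    · simpa using r0
    · simpa using r1
    · simpa using r2
    · simp [r3, r2]
    · simp [r3, r2, r4]
    · simpa using a0
    · simpa using a1
    · simpa [r2] using update_le_one ub _
    · simpa [r2, r3, r4, add_assoc] using key
  · simp [r2, h6] at hlt
    have he : s.reg 10 ≠ s.arr 3 p := by omega
    have key := lay.insert hA h9 hU h10 h11 he hd
    refine .step (by omega) (.store (by simp; omega) ?_)
    refine .step (by omega) (.store (by simp; omega) ?_)
    refine .step (by omega) (.sub (by simp [r3, r2]; omega) ?_)
    refine .step (by omega) (.store (by simp; omega) ?_)
    refine .step (by omega) (.store (by simp; omega) ?_)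
    refine .last (by omega) (.add (by simp [r3, r2]; omega) ?_)
    constructor
    · simpa using r0
    · simpa using r1
    · simpa using r2
    · simp [r3, r2]
    · simp [r3, r2, r4]
    · simpa using a0
    · simpa using a1
    · simpa [r2] using update_le_one ub _
    · simpa [r2, r3, r4, h5, add_assoc] using key

theorem runs_placeColumn (hW : 4 * ((n + 1) * (k + 1)) ≤ W) (hA : ∀ c, A c ≤ 1) {p : ℕ}
    (hp : p + 1 < k) (h : PlaceInv n k A p s) :
    Runs W placeColumn s (k * (n * 10 + 46) + 21) (PlaceInv n k A (p + 1)) := by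
  have hW4 : 4 * (k + 1) ≤ W := by nlinarith
  have hL := h.layout.bit p (by omega)
  have hS := h.layout.lt p (by omega)
  obtain ⟨r0, r1, r2, r3, r4, a0, a1, ub, lay⟩ := id h
  refine .step (by omega) (.sub (by omega) ?_)
  refine .step (by omega) (.load (by simp [r3, r2]; omega) ?_)
  refine .step (by omega) (.load (by simp [r3, r2]; omega) ?_)
  refine (runs_scan (U := s.arr 5) hW hA (by simp [r0]) (by simp [r1]) (by simp [r2])
    (by simp [r3, r2, hS]) (by simp [a0]) (by simp) (fun j _ => ub j)
    (lay.exists_unused hp)).seq (by omega) ?_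
  rintro s₁ ⟨hreg, harr, h7, hU7, hF, hno⟩
  simp only [RamState.reg_setReg, RamState.arr_setReg] at hreg harr hF hno
  norm_num [r3, r2] at hF hno
  have e5 := hreg 5 (by omega)
  have e6 := hreg 6 (by omega)
  norm_num [r3, r2] at e5 e6
  have m2 := harr 2 (by omega)
  have m3 := harr 3 (by omega)
  have m4 := harr 4 (by omega)
  have m5 := harr 5 (by omega)
  have hinv : PlaceInv n k A p s₁ := by
    constructor
    · simp [hreg 0, r0]
    · simp [hreg 1, r1]
    · simp [hreg 2, r2]
    · simp [hreg 3, r3]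
    · simp [hreg 4, r4, m4]
    · rw [harr 0 (by omega), a0]
    · rw [harr 1 (by omega)]; exact a1
    · rw [m5]; exact ub
    · rw [m2, m3, m4, m5]; exact lay
  refine .ite (by omega) (fun h8 => ?_) (fun h8 => ?_)
  · rw [hinv.reg_one] at h8
    refine (runs_placeGap hW hp hinv h7 (by rwa [m5]) h8 ?_).mono (by omega) fun _ h => h
    rw [m2, m5]
    simpa using hno (by omega)
  · rw [hinv.reg_one] at h8
    obtain h8' | ⟨h9, hU9, h10, h11, hd⟩ := hF
    · exact absurd h8' h8
    · exact (runs_placeFound hW hA hp hinv (by rw [m2, e5]) (by rw [m3, e6]) h9 (by rwa [m5]) h10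
        h11 (by rwa [m2])).mono (by omega) fun _ h => h

end FibProg

/-! ### Correctness and running time of the output phase, and of the whole program -/

theorem layoutEntry_zero (k : ℕ) (A S L Q : ℕ → ℕ) (v c : ℕ) : layoutEntry k A S L Q 0 v c = 0 := by
  simp [layoutEntry]

theorem IsLayout.layoutEntry_succ {n k m t : ℕ} {A S L Q U : ℕ → ℕ} (h : IsLayout n k A m S L Q U)
    (ht : t < m) (v c : ℕ) :
    layoutEntry k A S L Q (t + 1) v c =
      if c = Q t then (if A (v * k + S t) = L t then 1 else 0) else layoutEntry k A S L Q t v c := by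
  classical
  unfold layoutEntry
  by_cases hc : c = Q t
  · subst hc
    rw [if_pos rfl]
    refine if_congr ⟨?_, fun h1 => ⟨t, by omega, rfl, h1⟩⟩ rfl rfl
    rintro ⟨r, hr, h1, h2⟩
    rwa [h.column_inj (by omega) ht h1] at h2
  · rw [if_neg hc]
    refine if_congr ⟨?_, fun ⟨r, hr, h1⟩ => ⟨r, by omega, h1⟩⟩ rfl rfl
    rintro ⟨r, hr, h1, h2⟩
    rcases Nat.lt_succ_iff_lt_or_eq.1 hr with h3 | rfl
    · exact ⟨r, h3, h1, h2⟩
    · exact absurd h1.symm hc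

theorem mul_add_eq_mul_add_iff {f v v' c c' : ℕ} (hc : c < f) (hc' : c' < f) :
    v * f + c = v' * f + c' ↔ v = v' ∧ c = c' := by
  constructor
  · intro h
    have hf : 0 < f := by omega
    have h1 := congrArg (· / f) h
    have h2 := congrArg (· % f) h
    simp only [mul_comm _ f, Nat.mul_add_div hf, Nat.mul_add_mod, Nat.div_eq_of_lt hc,
      Nat.div_eq_of_lt hc', Nat.mod_eq_of_lt hc, Nat.mod_eq_of_lt hc', add_zero] at h1 h2
    exact ⟨h1, h2⟩
  · rintro ⟨rfl, rfl⟩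
    rfl

namespace FibProg

variable {W n k f : ℕ} {A S L Q U : ℕ → ℕ} {s : RamState}

/-- The machine state while the output is written, before row `v`, as far as it stays unchanged
within the row. -/
structure WriteFrame (n k f : ℕ) (A S L Q : ℕ → ℕ) (v : ℕ) (s : RamState) : Prop where
  reg_n : s.reg 0 = n
  reg_k : s.reg 1 = k
  reg_one : s.reg 2 = 1
  reg_f : s.reg 4 = f
  reg_row : s.reg 5 = v
  input : s.arr 0 = A
  arr_S : s.arr 2 = S
  arr_L : s.arr 3 = L
  arr_Q : s.arr 4 = Q

/-- The output table is complete up to place `t` of row `v`. -/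
def Written (n k f : ℕ) (A S L Q : ℕ → ℕ) (v t : ℕ) (s : RamState) : Prop :=
  ∀ v' < n, ∀ c < f, s.arr 1 (v' * f + c) =
    if v' < v then layoutEntry k A S L Q k v' c else
      if v' = v then layoutEntry k A S L Q t v c else 0

theorem Written.next_row {v : ℕ} (h : Written n k f A S L Q v k s) :
    Written n k f A S L Q (v + 1) 0 s := by
  intro v' hv' c hc
  rw [h v' hv' c hc, layoutEntry_zero, ite_self]
  rcases lt_trichotomy v' v with h1 | rfl | h1
  · rw [if_pos h1, if_pos (by omega)]
  · simp
  · rw [if_neg (by omega), if_neg (by omega), if_neg (by omega)]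

theorem runs_writeEntry (hW : 4 * ((n + 1) * (k + 1)) ≤ W) (hA : ∀ c, A c ≤ 1)
    (hlay : IsLayout n k A k S L Q U) (hf : f ≤ 2 * k) (hQf : ∀ t < k, Q t < f) {v t : ℕ}
    (hv : v < n) (ht : t < k) (h : WriteFrame n k f A S L Q v s) (h6 : s.reg 6 = v * k)
    (h7 : s.reg 7 = v * f) (h8 : s.reg 8 = t) (hw : Written n k f A S L Q v t s) :
    Runs W writeEntry s 12 fun s' => WriteFrame n k f A S L Q v s' ∧ s'.reg 6 = v * k ∧
      s'.reg 7 = v * f ∧ s'.reg 8 = t + 1 ∧ Written n k f A S L Q v (t + 1) s' := by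
  have hW4 : 4 * (k + 1) ≤ W := by nlinarith
  have hS := hlay.lt t ht
  have hL := hlay.bit t ht
  have hQ := hQf t ht
  have b1 := index_lt hW hv hS
  -- The output can be twice as wide as the input, `f ≤ 2k`; the factor `4` in `hW` leaves room for
  -- it.
  have b2 : v * f + Q t < W := by nlinarith
  have a1 := hA (v * k + S t)
  obtain ⟨r0, r1, r2, r4, r5, m0, m2, m3, m4⟩ := h
  refine .step (by omega) (.load (by simp [m2, h8]; omega) ?_)
  refine .step (by omega) (.add (by simp [m2, h8, h6]; omega) ?_)
  refine .step (by omega) (.load (by simp [m2, h8, h6, m0]; omega) ?_)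
  refine .step (by omega) (.load (by simp [m3, h8]; omega) ?_)
  refine .step (by omega) (.load (by simp [m4, h8]; omega) ?_)
  refine .step (by omega) (.add (by simp [m4, h8, h7]; omega) ?_)
  refine .step (by omega) (.sub (by simp [m0, m2, m3, h8, h6]; omega) ?_)
  refine .step (by omega) (.sub (by simp [m0, m2, m3, h8, h6]; omega) ?_)
  refine .step (by omega) (.add (by simp [m0, m2, m3, h8, h6]; omega) ?_)
  refine .step (by omega) (.sub (by simp [m0, m2, m3, h8, h6, r2]; omega) ?_)
  refine .step (by omega) (.store (by simp [m0, m2, m3, h8, h6, r2]; omega) ?_)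
  refine .last (by omega) (.add (by simp [h8, r2]; omega) ⟨⟨?_, ?_, ?_, ?_, ?_, ?_, ?_, ?_, ?_⟩,
    ?_, ?_, ?_, ?_⟩)
  · simpa using r0
  · simpa using r1
  · simpa using r2
  · simpa using r4
  · simpa using r5
  · simpa using m0
  · simpa using m2
  · simpa using m3
  · simpa using m4
  · simpa using h6
  · simpa using h7
  · simp [h8, r2]
  · intro v' hv' c hc
    simp [m0, m2, m3, m4, h8, h6, h7, r2, Function.update_apply, mul_add_eq_mul_add_iff hc hQ]
    rw [hw v' hv' c hc, hlay.layoutEntry_succ ht]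
    rcases lt_trichotomy v' v with h1 | rfl | h1
    · rw [if_neg (by omega), if_pos h1, if_pos h1]
    · simp only [lt_irrefl, if_false, if_true, true_and]
      refine if_congr Iff.rfl ?_ rfl
      split_ifs <;> omega
    · rw [if_neg (by omega), if_neg (by omega), if_neg (by omega), if_neg (by omega),
        if_neg (by omega)]

theorem runs_writeRow (hW : 4 * ((n + 1) * (k + 1)) ≤ W) (hA : ∀ c, A c ≤ 1)
    (hlay : IsLayout n k A k S L Q U) (hf : f ≤ 2 * k) (hQf : ∀ t < k, Q t < f) {v : ℕ}
    (hv : v < n) (h : WriteFrame n k f A S L Q v s) (hw : Written n k f A S L Q v 0 s) :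
    Runs W writeRow s (k * 13 + 5) fun s' => WriteFrame n k f A S L Q (v + 1) s' ∧
      Written n k f A S L Q (v + 1) 0 s' := by
  have hW4 : 4 * (n + 1) ≤ W := by nlinarith
  have b1 : v * k < W := by nlinarith
  have b2 : v * f < W := by nlinarith
  obtain ⟨r0, r1, r2, r4, r5, m0, m2, m3, m4⟩ := h
  refine .step (by omega) (.mul (by rwa [r5, r1]) ?_)
  refine .step (by omega) (.mul (by simpa [r5, r4] using b2) ?_)
  refine .step (by omega) (.const (by omega) ?_)
  refine Runs.seq (T₁ := k * (12 + 1) + 1) (Runs.loop (T := 12) (fun t s' =>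
    WriteFrame n k f A S L Q v s' ∧ s'.reg 6 = v * k ∧
      s'.reg 7 = v * f ∧ s'.reg 8 = t ∧ Written n k f A S L Q v t s') k ?_ ?_ ?_) (by omega) ?_
  · rintro t ht s₁ ⟨hfr, e6, e7, e8, hw₁⟩
    exact ⟨by rw [e8, hfr.reg_k]; exact ht,
      runs_writeEntry hW hA hlay hf hQf hv ht hfr e6 e7 e8 hw₁⟩
  · rintro s₁ ⟨hfr, -, -, e8, -⟩
    rw [e8, hfr.reg_k]
    omega
  · refine ⟨⟨?_, ?_, ?_, ?_, ?_, ?_, ?_, ?_, ?_⟩, ?_, ?_, ?_, ?_⟩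
    · simpa using r0
    · simpa using r1
    · simpa using r2
    · simpa using r4
    · simpa using r5
    · simpa using m0
    · simpa using m2
    · simpa using m3
    · simpa using m4
    · simp [r5, r1]
    · simp [r5, r4]
    · simp
    · simpa [Written] using hw
  · rintro s₁ ⟨⟨r0, r1, r2, r4, r5, m0, m2, m3, m4⟩, -, -, -, hw₁⟩
    refine .last (by omega) (.add (by rw [r5, r2]; omega)
      ⟨⟨?_, ?_, ?_, ?_, ?_, ?_, ?_, ?_, ?_⟩, ?_⟩)
    · simpa using r0
    · simpa using r1
    · simpa using r2
    · simpa using r4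
    · simp [r5, r2]
    · simpa using m0
    · simpa using m2
    · simpa using m3
    · simpa using m4
    · simpa [Written] using hw₁.next_row

theorem runs_writeTable (hW : 4 * ((n + 1) * (k + 1)) ≤ W) (hA : ∀ c, A c ≤ 1) {p : ℕ}
    (hk : k = p + 1) (h : PlaceInv n k A p s) :
    Runs W writeTable s (n * (k * 13 + 5 + 1) + 5) fun s' =>
      s'.reg 0 = s.arr 4 p + 1 ∧ ∀ v < n, ∀ c < s.arr 4 p + 1, s'.arr 1 (v * (s.arr 4 p + 1) + c) =
        layoutEntry k A (s.arr 2) (s.arr 3) (s.arr 4) k v c := by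
  have hW4 : 4 * (k + 1) ≤ W := by nlinarith
  have hnW : n < W := by nlinarith
  have hq := h.layout.column_le p (by omega)
  obtain ⟨r0, r1, r2, r3, r4, a0, a1, ub, lay⟩ := h
  rw [← hk] at lay
  have hQf : ∀ t < k, s.arr 4 t < s.arr 4 p + 1 := fun t ht => by
    rcases Nat.lt_or_ge t p with h1 | h1
    · have := lay.lt_of_lt h1 (by omega)
      omega
    · obtain rfl : t = p := by omega
      omega
  refine .step (by omega) (.add (by rw [r4, r2]; omega) ?_)
  refine .step (by omega) (.const (by omega) ?_)
  refine Runs.seq (T₁ := n * (k * 13 + 5 + 1) + 1) (Runs.loop (T := k * 13 + 5) (fun v s' =>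
    WriteFrame n k (s.arr 4 p + 1) A (s.arr 2) (s.arr 3) (s.arr 4) v s' ∧
      Written n k (s.arr 4 p + 1) A (s.arr 2) (s.arr 3) (s.arr 4) v 0 s') n ?_ ?_ ?_) (by omega) ?_
  · rintro v hv s₁ ⟨hfr, hw⟩
    exact ⟨by rw [hfr.reg_row, hfr.reg_n]; exact hv,
      runs_writeRow hW hA lay (by omega) hQf hv hfr hw⟩
  · rintro s₁ ⟨hfr, -⟩
    rw [hfr.reg_row, hfr.reg_n]
    omega
  · refine ⟨⟨?_, ?_, ?_, ?_, ?_, ?_, ?_, ?_, ?_⟩, ?_⟩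
    · simpa using r0
    · simpa using r1
    · simpa using r2
    · simp [r4, r2]
    · simp
    · simpa using a0
    · simp
    · simp
    · simp
    · intro v _ c _
      simp [a1, layoutEntry_zero]
  · rintro s₁ ⟨hfr, hw⟩
    refine .step (by omega) (.const (by omega) ?_)
    refine .last (by omega) (.add (by simp [hfr.reg_f]; omega) ⟨by simp [hfr.reg_f], ?_⟩)
    intro v hv c hc
    have := hw v hv c hc
    rw [if_pos hv] at this
    simpa using this

theorem runs_main (hW : 4 * ((n + 1) * (k + 1)) ≤ W) (hA : ∀ c, A c ≤ 1) (hk : 0 < k)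
    (h0 : s.reg 0 = n) (h1 : s.reg 1 = k) (h4 : s.reg 4 = 0) (hA0 : s.arr 0 = A)
    (harr : ∀ a, a ≠ 0 → ∀ c, s.arr a c = 0) (hn : 0 < n) :
    Runs W main s (200 * (k ^ 2 * n)) fun s' => ∃ S L Q U, IsLayout n k A k S L Q U ∧
      s'.reg 0 = Q (k - 1) + 1 ∧ ∀ v < n, ∀ c < Q (k - 1) + 1,
        s'.arr 1 (v * (Q (k - 1) + 1) + c) = layoutEntry k A S L Q k v c := by
  have hW4 : 4 * (k + 1) ≤ W := by nlinarith
  obtain ⟨p, rfl⟩ : ∃ p, k = p + 1 := ⟨k - 1, by omega⟩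
  suffices hT : Runs W main s
      (p * ((p + 1) * (n * 10 + 46) + 21 + 1) + 1 + (n * ((p + 1) * 13 + 5 + 1) + 5) + 5) fun s' =>
      ∃ S L Q U, IsLayout n (p + 1) A (p + 1) S L Q U ∧
      s'.reg 0 = Q (p + 1 - 1) + 1 ∧ ∀ v < n, ∀ c < Q (p + 1 - 1) + 1,
        s'.arr 1 (v * (Q (p + 1 - 1) + 1) + c) = layoutEntry (p + 1) A S L Q (p + 1) v c by
    refine hT.mono ?_ fun _ h => h
    -- In terms of `p = k - 1` and `m = n - 1`, the time bound is below `200 (p + 1)² (m + 1)`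
    -- coefficient by coefficient.
    obtain ⟨m, rfl⟩ : ∃ m, n = m + 1 := ⟨n - 1, by omega⟩
    nlinarith [Nat.zero_le (p * m), Nat.zero_le (p * p * m), Nat.zero_le (p * p)]
  refine .step (by omega) (.const (by omega) ?_)
  refine .ite (by omega) (fun h => ?_) fun _ => ?_
  · simp [h1] at h
  refine .step (by omega) (.const (by omega) ?_)
  refine .step (by omega) (.const (by omega) ?_)
  refine .step (by omega) (.store (by simp; omega) ?_)
  refine (Runs.loop (T := (p + 1) * (n * 10 + 46) + 21) (PlaceInv n (p + 1) A) p ?_ ?_ ?_).seq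
    (by omega) ?_
  · intro x hx s₁ h
    exact ⟨by rw [h.reg_count, h.reg_k]; omega, runs_placeColumn hW hA (by omega) h⟩
  · intro s₁ h
    rw [h.reg_count, h.reg_k]
    omega
  · have hz : ∀ a, a ≠ 0 → s.arr a = fun _ => 0 := fun a ha => funext (harr a ha)
    constructor
    · simpa using h0
    · simpa using h1
    · simp
    · simp
    · simp [h4, harr 4]
    · simpa using hA0
    · simpa using harr 1
    · simpa using update_le_one (fun j => by simp [harr 5]) _
    -- Zeroed memory already encodes the first place, column `0` with sign `0` in output column `0`;
    -- only its mark of use had to be stored.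
    · constructor
      · intro t ht
        simp [harr 2]
      · intro t ht
        simp [harr 3]
      · intro t ht r hr
        omega
      · intro j hj
        simp [hz 5, hz 2, Function.update_apply, eq_comm]
      · simp [harr 4]
      · intro t ht
        omega
  · intro s₁ h
    refine (runs_writeTable hW hA rfl h).mono (by omega) ?_
    rintro s₂ ⟨e0, e1⟩
    exact ⟨_, _, _, _, h.layout, e0, e1⟩

end FibProg

/-! ### The input convention and the assembly of the theorem -/

theorem holdsTable_inputState {n k : ℕ} (β : Fin n → Fin k → Bool) :
    HoldsTable ((inputState β).arr 0) β := by
  intro v i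
  have hlt : (v : ℕ) * k + i < n * k := by
    have := v.2
    have := i.2
    nlinarith
  have he : finProdFinEquiv.symm ⟨(v : ℕ) * k + i, hlt⟩ = (v, i) := by
    rw [Equiv.symm_apply_eq]
    ext
    simp [finProdFinEquiv]
    ring
  change dite _ _ _ = _
  rw [dif_pos ⟨rfl, hlt⟩, he]

theorem inputState_arr_zero_le {n k : ℕ} (β : Fin n → Fin k → Bool) (c : ℕ) :
    (inputState β).arr 0 c ≤ 1 := by
  simp only [inputState]
  split_ifs
  · exact Bool.toNat_le _
  · omega

theorem mainTheorem5 :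
    ∃ (P : RamProg) (C c : ℕ), ∀ (n k : ℕ) (G : SimpleGraph (Fin n)) (β : Fin n → (Fin k → Bool)),
      G.Connected → IsIsometricEmbedding G (cubeGraph k) β → idim G = (k : ℕ∞) →
      ∃ (t : ℕ) (s : RamState) (f : ℕ) (φ : Fin n → fibStrings f),
        RamExec ((n + 1) ^ c) P (inputState β) t s ∧
        t ≤ C * ((max k 1) ^ 2 * n) ∧
        1 ≤ f ∧
        IsOutput s φ ∧
        IsIsometricEmbedding G (fibCube f) φ ∧
        2 * (f : ℕ∞) ≤ 3 * fdim G := by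
  refine ⟨FibProg.main, 200, 5, fun n k G β hG hβ hk => ?_⟩
  have hn : 0 < n := Fin.pos_iff_nonempty.2 hG.nonempty
  rw [← isHammingLabelling_iff] at hβ
  have hc := exists_apply_ne_of_idim_eq hβ hk
  have hkn := hβ.le_card_sq hG hc
  -- The exponent `5` is `2 + 1 + 2`: `4 ≤ (n + 1)²` as `n ≥ 1`, and `k + 1 ≤ (n + 1)²` as `k ≤ n²`.
  have hW : 4 * ((n + 1) * (k + 1)) ≤ (n + 1) ^ 5 := by
    calc 4 * ((n + 1) * (k + 1)) ≤ (n + 1) ^ 2 * ((n + 1) * (n + 1) ^ 2) := by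
          gcongr <;> nlinarith
      _ = (n + 1) ^ 5 := by ring
  rcases Nat.eq_zero_or_pos k with rfl | hpos
  · have hW1 : 1 < (n + 1) ^ 5 := by omega
    obtain ⟨t, s, hex, ht, h0, h1⟩ : Runs ((n + 1) ^ 5) FibProg.main (inputState β) 3 fun s =>
        s.reg 0 = 1 ∧ ∀ c, s.arr 1 c = 0 := by
      refine .step (by omega) (.const hW1 ?_)
      refine .ite (by omega) (fun _ => ?_) fun h => ?_
      · exact .last (by omega) (.const hW1 ⟨by simp, by simp [inputState]⟩)
      · simp [inputState] at h
    -- For `k = 0` all labels coincide, so all distances vanish and `G` is a single vertex; one zero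
    -- column then suffices.
    have hsub : ∀ u v : Fin n, u = v := fun u v => by
      have := hβ u v
      rw [Subsingleton.elim (β u) (β v), hammingDist_self] at this
      exact SimpleGraph.edist_eq_zero_iff.1 (by exact_mod_cast this)
    refine ⟨t, s, 1, fun _ => ⟨fun _ => false, fun i j _ h => by simp at h⟩, hex, ?_, le_rfl,
      ⟨h0, fun v i => by simp [h1]⟩, fun u v => by simp [hsub u v],
      two_mul_le_three_mul_fdim fun f hf _ _ => by omega⟩
    simp only [zero_le, sup_of_le_right, one_pow, one_mul]
    omega
  · obtain ⟨t, s, hex, ht, S, L, Q, U, hlay, h0, h1⟩ := FibProg.runs_main (s := inputState β) hW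
      (inputState_arr_zero_le β) hpos (by simp [inputState]) (by simp [inputState])
      (by simp [inputState]) rfl (fun a ha c => by simp [inputState, ha]) hn
    obtain ⟨φ, hφ, hiso⟩ := hlay.exists_embedding (holdsTable_inputState β) hpos hβ
    refine ⟨t, s, Q (k - 1) + 1, φ, hex, ?_, by omega, ⟨h0, fun v i => ?_⟩, hiso,
      two_mul_le_three_mul_fdim fun f _ ψ hψ =>
        hlay.two_mul_le (holdsTable_inputState β) hpos hG hβ hψ hc⟩
    · rwa [max_eq_left hpos]
    · rw [h1 v v.2 i i.2, hφ]
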